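/- Let $n,s\ge 1$ and let $M^{2n+s}$ be a smooth manifold with a Riemannian metric $g$, Levi-Civita connection $\nabla$, and curvature tensor $R_{X,Y}=\nabla_X\nabla_Y-\nabla_Y\nabla_X-\nabla_{[X,Y]}$. A weak almost $\mathcal S$-structure on $M$ consists of smooth $(1,1)$-tensors $f$ (of rank $2n$) and $Q$ (non-singular), vector fields $\xi_i$ and 1-forms $\eta^i$ $(1\le i\le s)$ such that $$f^2=-Q+\sum_i\eta^i\otimes\xi_i,\quad \eta^i(\xi_j)=\delta^i_j,\quad Q\xi_i=\xi_i,\quad g(fX,fY)=g(X,QY)-\sum_i\eta^i(X)\eta^i(Y),$$ and $\Phi=d\eta^1=\dots=d\eta^s$, where $\Phi(X,Y)=g(X,fY)$ and $d\eta(X,Y)=\tfrac12\{X(\eta(Y))-Y(\eta(X))-\eta([X,Y])\}$. Put $\widetilde Q=Q-I$, $\bar\eta=\sum_i\eta^i$, $\bar\xi=\sum_i\xi_i$, $\mathcal D=\bigcap_i\ker\eta^i$, $h_i=\tfrac12\pounds_{\xi_i}f$, $\widetilde h_i=Q^{-1}h_i$, $P(X,Y)=\tfrac12[(\nabla_Xf)\widetilde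 QY+(\nabla_{\widetilde QX}f)Y]$. Let $M$ carry a weak almost $\mathcal S$-structure with $\pounds_{\xi_i}Q=0$ for all $i$. Then for all vector fields $X,Y,Z$ and all $i$: (1) $$g(R_{\xi_i,X}Y,Z)=-(\nabla_X\Phi)(Y,Z)-g(X,(\nabla_Y f\widetilde h_i)Z)+g(X,(\nabla_Z f\widetilde h_i)Y).$$ If moreover $(\nabla_XQ)Y=0$ for all vector fields $X,Y$ tangent to $\mathcal D$, then for all vector fields $X,Y,Z$ and all $i$: (2) $$\begin{aligned} &g(R_{\xi_i,X}Y,Z)+g(R_{\xi_i,\widetilde QX}Y,Z)-g(R_{\xi_i,X}fY,fZ)+g(R_{\xi_i,fX}Y,fZ)+g(R_{\xi_i,fX}fY,Z)\\ &=2(\nabla_{\widetilde h_iX}\Phi)(Y,Z)+2\bar\eta(Z)g(X+\widetilde h_iX,QY)-2\bar\eta(Y)g(X+\widetilde h_iX,QZ)\\ &\quad-2\sum_j\eta^j(X)\big[\eta^j(Y)\bar\eta(Z)-\bar\eta(Y)\eta^j(Z)\big] +\tfrac12\Big[\sum_j\big\{2\eta^j(X)g(\widetilde QQ(I-\widetilde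 h_j)Z,Y)\\ &\quad-5\eta^j(Y)g(\widetilde QQ(I-\widetilde h_j)Z,\widetilde h_iX+\tfrac25X)+5\eta^j(Z)g(\widetilde QQ(I-\widetilde h_j)Y,\widetilde h_iX)\big\}\\ &\quad-(\nabla_{\widetilde QY}\Phi)(Z,\widetilde h_iX)+(\nabla_Y\Phi)(\widetilde h_iZ,\widetilde QX)+3(\nabla_{\widetilde Q\widetilde h_iX}\Phi)(Y,Z)-(\nabla_{\widetilde QY}\Phi)(\widetilde h_iZ,X)\\ &\quad-(\nabla_{\widetilde QZ}\Phi)(\widetilde h_iX,Y)+(\nabla_Z\Phi)(\widetilde QX,\widetilde h_iY)-(\nabla_{\widetilde QZ}\Phi)(X,\widetilde h_iY)\Big], \end{aligned}$$ (3) $$\begin{aligned} (\nabla_Xf)Y+(\nabla_{fX}f)fY&=2g(fX,fY)\bar\xi+\bar\eta(Y)f^2X-\sum_j\eta^j(Y)h_jX-P(X,Y)\\ &\quad+\tfrac12\sum_j\big[\widetilde QQ(I-\widetilde h_j)\{\eta^j(X)Y-\eta^j(Y)X\}+g(\widetilde QQ(I-\widetilde h_j)Y,X)\xi_j\big]. \end{aligned}$$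 -/

import Mathlib

open Bundle
open scoped Manifold ContDiff

noncomputable section

namespace WeakF

section Riemannian

variable {E : Type*} [NormedAddCommGroup E] [NormedSpace ℝ E]
  {M : Type*} [TopologicalSpace M] [ChartedSpace E M]

variable (E M) in
/-- (Not necessarily smooth) vector fields on the boundaryless manifold `M` modelled on `E`. -/
abbrev VField := Π x : M, TangentSpace 𝓘(ℝ, E) x

/-- Smooth vector fields, the elements of `𝔛_M`. -/
def IsSmoothVF [IsManifold 𝓘(ℝ, E) ∞ M] (X : VField E M) : Prop :=
  ContMDiff 𝓘(ℝ, E) 𝓘(ℝ, E).tangent ∞ (fun x => (⟨x, X x⟩ : TangentBundle 𝓘(ℝ, E) M))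

/-- The Lie bracket `[X, Y]`. -/
def bracket (X Y : VField E M) : VField E M := VectorField.mlieBracket 𝓘(ℝ, E) X Y

/-- The derivative `X(φ)` of a function `φ` along a vector field `X`. -/
def dirDeriv (X : VField E M) (φ : M → ℝ) : M → ℝ := fun x => mvfderiv 𝓘(ℝ, E) φ x (X x)

/-- The Lie derivative `(£_ξ S) X = [ξ, S X] - S [ξ, X]` of a (1,1)-tensor, given as an operator
on vector fields. -/
def lieDerivEndo (ξ : VField E M) (S : VField E M → VField E M) (X : VField E M) : VField E M :=
  fun x => bracket ξ (S X) x - S (bracket ξ X) x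

/-- The exterior derivative of a 1-form, with the normalizing factor `1/2`. -/
def extDeriv (η : Π x : M, TangentSpace 𝓘(ℝ, E) x →L[ℝ] ℝ) (X Y : VField E M) : M → ℝ :=
  fun x => (1 / 2 : ℝ) * (dirDeriv X (fun y => η y (Y y)) x - dirDeriv Y (fun y => η y (X y)) x
    - η x (bracket X Y x))

variable [RiemannianBundle (fun x : M => TangentSpace 𝓘(ℝ, E) x)]

/-- The function `g(X, Y)`. -/
def metric (X Y : VField E M) : M → ℝ := fun x => inner ℝ (X x) (Y x)

/-- The right-hand side of the Koszul formula for `2 g(∇_X Y, Z)`. -/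
def koszul (X Y Z : VField E M) : M → ℝ := fun x =>
  dirDeriv X (metric Y Z) x + dirDeriv Y (metric Z X) x - dirDeriv Z (metric X Y) x
    + metric (bracket X Y) Z x - metric (bracket X Z) Y x - metric (bracket Y Z) X x

variable [FiniteDimensional ℝ E] [IsManifold 𝓘(ℝ, E) ∞ M]

instance (x : M) : FiniteDimensional ℝ (TangentSpace 𝓘(ℝ, E) x) :=
  inferInstanceAs (FiniteDimensional ℝ E)

/-- The Levi-Civita derivative `∇_X Y`: at the point `x` it is the vector whose inner product
with each vector `e` of an orthonormal basis of `T_x M` is given by the Koszul formula, applied to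
any extension of `e` to a vector field near `x` (see `two_mul_metric_nabla`). -/
def nabla (X Y : VField E M) : VField E M := fun x =>
  ∑ k, ((1 / 2 : ℝ) * koszul X Y
      (FiberBundle.extend E (stdOrthonormalBasis ℝ (TangentSpace 𝓘(ℝ, E) x) k)) x) •
    stdOrthonormalBasis ℝ (TangentSpace 𝓘(ℝ, E) x) k

/-- The covariant derivative `(∇_X S) Y = ∇_X (S Y) - S (∇_X Y)` of a (1,1)-tensor `S`, given as
an operator on vector fields. -/
def nablaEndo (S : VField E M → VField E M) (X Y : VField E M) : VField E M :=
  fun x => nabla X (S Y) x - S (nabla X Y) x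

/-- The covariant derivative of a 2-form:
`(∇_X Φ)(Y, Z) = X(Φ(Y, Z)) - Φ(∇_X Y, Z) - Φ(Y, ∇_X Z)`. -/
def nablaForm (Φ : VField E M → VField E M → M → ℝ) (X Y Z : VField E M) : M → ℝ :=
  fun x => dirDeriv X (Φ Y Z) x - Φ (nabla X Y) Z x - Φ Y (nabla X Z) x

/-- The curvature tensor `R_{X,Y} Z = ∇_X ∇_Y Z - ∇_Y ∇_X Z - ∇_{[X,Y]} Z`. -/
def curv (X Y Z : VField E M) : VField E M :=
  fun x => nabla X (nabla Y Z) x - nabla Y (nabla X Z) x - nabla (bracket X Y) Z x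

end Riemannian

section KoszulFormula

variable {E : Type*} [NormedAddCommGroup E] [NormedSpace ℝ E]
  {M : Type*} [TopologicalSpace M] [ChartedSpace E M] [IsManifold 𝓘(ℝ, E) ∞ M]
  [RiemannianBundle (fun x : M => TangentSpace 𝓘(ℝ, E) x)]
  [IsContMDiffRiemannianBundle 𝓘(ℝ, E) ∞ E (fun x : M => TangentSpace 𝓘(ℝ, E) x)]

theorem metric_mdiff {X Y : VField E M} {x : M}
    (hX : MDiffAt (T% X) x) (hY : MDiffAt (T% Y) x) : MDiffAt (metric X Y) x :=
  MDifferentiableAt.inner_bundle (F := E) (E := fun x : M => TangentSpace 𝓘(ℝ, E) x)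
    (b := fun x => x) hX hY

variable [FiniteDimensional ℝ E]

theorem koszul_tensorial {X Y : VField E M} {x : M}
    (hX : MDiffAt (T% X) x) (hY : MDiffAt (T% Y) x) :
    TensorialAt 𝓘(ℝ, E) E (fun Z : VField E M => koszul X Y Z x) x where
  smul {f Z} hf hZ := by
    have e1 : metric Y (f • Z) = fun y => f y * metric Y Z y := by
      funext y; simp [metric, inner_smul_right]
    have e2 : metric (f • Z) X = fun y => f y * metric Z X y := by
      funext y; simp [metric, inner_smul_left]
    have d1 : MDiffAt (metric Y Z) x := metric_mdiff hY hZ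
    have d2 : MDiffAt (metric Z X) x := metric_mdiff hZ hX
    simp only [koszul, dirDeriv, e1, e2, mvfderiv_fun_mul hf d1, mvfderiv_fun_mul hf d2]
    simp only [metric, bracket, VectorField.mlieBracket_smul_right hf hZ]
    simp [inner_add_left, inner_smul_left, inner_smul_right, real_inner_comm]
    ring
  add {Z Z'} hZ hZ' := by
    have e1 : metric Y (Z + Z') = fun y => metric Y Z y + metric Y Z' y := by
      funext y; simp [metric, inner_add_right]
    have e2 : metric (Z + Z') X = fun y => metric Z X y + metric Z' X y := by
      funext y; simp [metric, inner_add_left]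
    have d1 : MDiffAt (metric Y Z) x := metric_mdiff hY hZ
    have d1' : MDiffAt (metric Y Z') x := metric_mdiff hY hZ'
    have d2 : MDiffAt (metric Z X) x := metric_mdiff hZ hX
    have d2' : MDiffAt (metric Z' X) x := metric_mdiff hZ' hX
    simp only [koszul, dirDeriv, e1, e2, mvfderiv_fun_add d1 d1', mvfderiv_fun_add d2 d2']
    simp only [metric, bracket, VectorField.mlieBracket_add_right hZ hZ']
    simp [inner_add_left, inner_add_right]
    ring

/-- The Koszul formula, which characterizes the Levi-Civita connection. -/
theorem two_mul_metric_nabla {X Y Z : VField E M} {x : M}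
    (hX : MDiffAt (T% X) x) (hY : MDiffAt (T% Y) x) (hZ : MDiffAt (T% Z) x) :
    2 * metric (nabla X Y) Z x = koszul X Y Z x := by
  have hT := koszul_tensorial hX hY
  have key : ∀ v : TangentSpace 𝓘(ℝ, E) x, koszul X Y (FiberBundle.extend E v) x =
      TensorialAt.mkHom _ _ hT v := fun v => (TensorialAt.mkHom_apply_eq_extend hT v).symm
  have key2 : koszul X Y Z x = TensorialAt.mkHom _ _ hT (Z x) :=
    (TensorialAt.mkHom_apply hT hZ).symm
  have key3 := congrArg (TensorialAt.mkHom _ _ hT)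
    ((stdOrthonormalBasis ℝ (TangentSpace 𝓘(ℝ, E) x)).sum_repr' (Z x))
  rw [key2, ← key3]
  simp only [metric, nabla, key, sum_inner, inner_smul_left, map_sum, map_smul, Finset.mul_sum,
    smul_eq_mul, conj_trivial]
  refine Finset.sum_congr rfl fun k _ => ?_
  ring

/-- The Levi-Civita connection is torsion-free. -/
theorem nabla_sub_nabla {X Y Z : VField E M} {x : M}
    (hX : MDiffAt (T% X) x) (hY : MDiffAt (T% Y) x) (hZ : MDiffAt (T% Z) x) :
    metric (nabla X Y) Z x - metric (nabla Y X) Z x = metric (bracket X Y) Z x := by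
  have h1 := two_mul_metric_nabla hX hY hZ
  have h2 := two_mul_metric_nabla hY hX hZ
  have e : ∀ U V : VField E M, metric U V = metric V U := fun U V => by
    funext y; exact real_inner_comm _ _
  have e2 : metric (bracket Y X) Z x = - metric (bracket X Y) Z x := by
    simp only [metric, bracket]
    rw [VectorField.mlieBracket_swap_apply, inner_neg_left]
  simp only [koszul] at h1 h2
  rw [e X Z, e X Y, e Y Z] at *
  linarith

/-- The Levi-Civita connection is compatible with the metric. -/
theorem dirDeriv_metric {X Y Z : VField E M} {x : M}
    (hX : MDiffAt (T% X) x) (hY : MDiffAt (T% Y) x) (hZ : MDiffAt (T% Z) x) :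
    dirDeriv X (metric Y Z) x = metric (nabla X Y) Z x + metric Y (nabla X Z) x := by
  have h1 := two_mul_metric_nabla hX hY hZ
  have h2 := two_mul_metric_nabla hX hZ hY
  have e : ∀ U V : VField E M, metric U V = metric V U := fun U V => by
    funext y; exact real_inner_comm _ _
  have e2 : metric (bracket Z Y) X x = - metric (bracket Y Z) X x := by
    simp only [metric, bracket]
    rw [VectorField.mlieBracket_swap_apply, inner_neg_left]
  simp only [koszul] at h1 h2
  rw [e Y (nabla X Z)]
  rw [e Z Y, e X Z, e Y X, e2] at h2
  linarith

end KoszulFormula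
section Structures

variable (E : Type*) [NormedAddCommGroup E] [NormedSpace ℝ E]
  (M : Type*) [TopologicalSpace M] [ChartedSpace E M] [IsManifold 𝓘(ℝ, E) ∞ M]

/-- Smooth tensor fields `(f, Q, ξ_i, η^i)`: two (1,1)-tensors, `s` vector fields, `s` 1-forms. -/
structure Tensors (s : ℕ) where
  f : Π x : M, TangentSpace 𝓘(ℝ, E) x →L[ℝ] TangentSpace 𝓘(ℝ, E) x
  Q : Π x : M, TangentSpace 𝓘(ℝ, E) x →L[ℝ] TangentSpace 𝓘(ℝ, E) x
  ξ : Fin s → VField E M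
  η : Fin s → Π x : M, TangentSpace 𝓘(ℝ, E) x →L[ℝ] ℝ
  smooth_f : ContMDiff 𝓘(ℝ, E) (𝓘(ℝ, E).prod 𝓘(ℝ, E →L[ℝ] E)) ∞
    (fun x => TotalSpace.mk' (E →L[ℝ] E)
      (E := fun x : M => TangentSpace 𝓘(ℝ, E) x →L[ℝ] TangentSpace 𝓘(ℝ, E) x) x (f x))
  smooth_Q : ContMDiff 𝓘(ℝ, E) (𝓘(ℝ, E).prod 𝓘(ℝ, E →L[ℝ] E)) ∞
    (fun x => TotalSpace.mk' (E →L[ℝ] E)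
      (E := fun x : M => TangentSpace 𝓘(ℝ, E) x →L[ℝ] TangentSpace 𝓘(ℝ, E) x) x (Q x))
  smooth_ξ : ∀ i, IsSmoothVF (ξ i)
  smooth_η : ∀ i, ContMDiff 𝓘(ℝ, E) (𝓘(ℝ, E).prod 𝓘(ℝ, E →L[ℝ] ℝ)) ∞
    (fun x => TotalSpace.mk' (E →L[ℝ] ℝ)
      (E := fun x : M => TangentSpace 𝓘(ℝ, E) x →L[ℝ] ℝ) x (η i x))

end Structures

namespace Tensors

variable {E : Type*} [NormedAddCommGroup E] [NormedSpace ℝ E]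
  {M : Type*} [TopologicalSpace M] [ChartedSpace E M] [IsManifold 𝓘(ℝ, E) ∞ M] {s : ℕ}
  (T : Tensors E M s)

/-- A framed weak `f`-structure with `f` of rank `2n`. -/
structure IsFramedWeak (n : ℕ) : Prop where
  rank_f : ∀ x, Module.finrank ℝ (LinearMap.range (T.f x).toLinearMap) = 2 * n
  nonsingular : ∀ x, (T.Q x).IsInvertible
  f_sq : ∀ x v, T.f x (T.f x v) = - T.Q x v + ∑ i, T.η i x v • T.ξ i x
  η_ξ : ∀ i j x, T.η i x (T.ξ j x) = if i = j then 1 else 0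
  Q_ξ : ∀ i x, T.Q x (T.ξ i x) = T.ξ i x

/-- The tensor `f` acting on vector fields. -/
def fOp (X : VField E M) : VField E M := fun x => T.f x (X x)

/-- The tensor `Q` acting on vector fields. -/
def QOp (X : VField E M) : VField E M := fun x => T.Q x (X x)

/-- `Q̃ = Q - I`. -/
def Qt (X : VField E M) : VField E M := fun x => T.Q x (X x) - X x

/-- The 1-form `η^i` acting on vector fields. -/
def etaOp (i : Fin s) (X : VField E M) : M → ℝ := fun x => T.η i x (X x)

/-- `η̄ = ∑ η^i`. -/
def etaBar (X : VField E M) : M → ℝ := fun x => ∑ i, T.η i x (X x)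

/-- `h_i = (1/2) £_{ξ_i} f`. -/
def h (i : Fin s) (X : VField E M) : VField E M :=
  fun x => (1 / 2 : ℝ) • lieDerivEndo (T.ξ i) T.fOp X x

/-- `h̃_i = Q⁻¹ h_i`. -/
def ht (i : Fin s) (X : VField E M) : VField E M := fun x => (T.Q x).inverse (T.h i X x)

/-- `Q̃ Q (I - h̃_j)`. -/
def QQh (j : Fin s) (X : VField E M) : VField E M :=
  T.Qt (T.QOp (fun x => X x - T.ht j X x))

/-- `X` is a section of the contact distribution `D = ⋂ ker η^i`. -/
def InD (X : VField E M) : Prop := ∀ i x, T.η i x (X x) = 0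

/-- `£_{ξ_i} Q = 0` for all `i`. -/
def LieQZero : Prop :=
  ∀ i, ∀ X : VField E M, IsSmoothVF X → ∀ x, lieDerivEndo (T.ξ i) T.QOp X x = 0

variable [RiemannianBundle (fun x : M => TangentSpace 𝓘(ℝ, E) x)]

/-- The fundamental 2-form `Φ(X, Y) = g(X, f Y)`. -/
def Phi (X Y : VField E M) : M → ℝ := metric X (T.fOp Y)

/-- A weak metric `f`-structure: the Riemannian metric is compatible with the framed weak
`f`-structure. -/
structure IsWeakMetric (n : ℕ) : Prop extends T.IsFramedWeak n where
  compat : ∀ x (v w : TangentSpace 𝓘(ℝ, E) x),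
    inner ℝ (T.f x v) (T.f x w) = inner ℝ v (T.Q x w) - ∑ i, T.η i x v * T.η i x w

/-- A weak almost `S`-structure: `Φ = dη^1 = ⋯ = dη^s`. -/
structure IsWeakAlmostS (n : ℕ) : Prop extends T.IsWeakMetric n where
  dη_eq : ∀ i, ∀ X Y : VField E M, IsSmoothVF X → IsSmoothVF Y →
    ∀ x, T.Phi X Y x = extDeriv (T.η i) X Y x

variable [FiniteDimensional ℝ E]

/-- `(∇_X Q) Y = 0` for all sections `X`, `Y` of `D`. -/
def NablaQZeroOnD : Prop :=
  ∀ X Y : VField E M, IsSmoothVF X → IsSmoothVF Y → T.InD X → T.InD Y →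
    ∀ x, nablaEndo T.QOp X Y x = 0

/-- `(∇_X Φ)(Y, Z)`. -/
def nPhi (X Y Z : VField E M) : M → ℝ := nablaForm T.Phi X Y Z

/-- The tensor `P(X, Y) = (1/2) [(∇_X f) Q̃ Y + (∇_{Q̃ X} f) Y]`. -/
def P (X Y : VField E M) : VField E M :=
  fun x => (1 / 2 : ℝ) • (nablaEndo T.fOp X (T.Qt Y) x + nablaEndo T.fOp (T.Qt X) Y x)

/-- The tensor `f h̃_i` acting on vector fields. -/
def fht (i : Fin s) (X : VField E M) : VField E M := T.fOp (T.ht i X)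

end Tensors

end WeakF
end

/-! The smooth fields form a Lie–Rinehart algebra over the smooth functions, with a metric and its
Levi-Civita connection, and the three identities are algebra in that setting. Since `dη^i = Φ`, the
skew part of `∇ξ_i` is `-f`, so `∇ξ_i = S_i - f` with `S_i` symmetric (`S_symm`). The first Bianchi
identity paired with `ξ_i` shows that `Φ` is closed (`N_cyc`). From this follow `[ξ_i, ξ_j] = 0`,
`S_i ξ_j = 0` and `£_{ξ_i} f = -2 S_i f`; the condition `£_{ξ_i} Q = 0` then makes `S_i` anticommute
with `f` (`S_f`). Hence `h_i = f S_i` and `f h̃_i = -S_i`, and (1) is the pair symmetry of the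
curvature together with `∇ξ_i = S_i - f` and closedness (`curv_ξ`).

For (2) and (3) the point is that `Q` parallel along `D` forces `Q = I` (`Q_eq_self`). Every term
with `Q̃` then vanishes, and what remains concerns ordinary almost `S`-structures. There (3) follows
from closedness of `Φ` and the derivative of `f² = -I + ∑ η^j ⊗ ξ_j` (`N_add_N_f`). For (2), formula
(1) is inserted in the four surviving curvature terms; the derivatives of `S_i` reduce to
derivatives of `Φ` because `S_i` anticommutes with `f` (`nab_S_add`), and (3) removes the rest. -/

noncomputable section

/-- A Lie–Rinehart algebra `V` over `R` with a metric and its Levi-Civita connection: the algebraic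
properties of the smooth vector fields on a Riemannian manifold. -/
structure LeviCivita (R V : Type*) [CommRing R] [AddCommGroup V] [Module R V] where
  act : V → R → R
  br : V → V → V
  g : V →ₗ[R] V →ₗ[R] R
  nab : V → V → V
  g_comm : ∀ X Y, g X Y = g Y X
  g_self : ∀ X, g X X = 0 → X = 0
  act_add : ∀ X a b, act X (a + b) = act X a + act X b
  act_mul : ∀ X a b, act X (a * b) = a * act X b + b * act X a
  act_br : ∀ X Y a, act (br X Y) a = act X (act Y a) - act Y (act X a)
  jacobi : ∀ X Y Z, br X (br Y Z) = br (br X Y) Z + br Y (br X Z)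
  br_swap : ∀ X Y, br X Y = -br Y X
  br_add : ∀ X Y Z, br X (Y + Z) = br X Y + br X Z
  br_smul : ∀ X (a : R) Y, br X (a • Y) = a • br X Y + act X a • Y
  torsion : ∀ X Y, nab X Y - nab Y X = br X Y
  compat : ∀ X Y Z, act X (g Y Z) = g (nab X Y) Z + g Y (nab X Z)

/-! ### Connection and curvature identities in a Lie–Rinehart algebra. -/

namespace LeviCivita

variable {R V : Type*} [CommRing R] [AddCommGroup V] [Module R V] (L : LeviCivita R V)

theorem act_zero (X : V) : L.act X 0 = 0 := by
  simpa using L.act_add X 0 0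

theorem act_one (X : V) : L.act X 1 = 0 := by
  simpa using L.act_mul X 1 1

theorem ext_g {X Y : V} (h : ∀ Z, L.g Z X = L.g Z Y) : X = Y :=
  sub_eq_zero.1 (L.g_self _ (by rw [map_sub, h, sub_self]))

/-- Metric compatibility and nondegeneracy force linearity in the second argument, so it need not be
an axiom; vanishing torsion later carries it over to the first argument. -/
theorem nab_add (X Y Z : V) : L.nab X (Y + Z) = L.nab X Y + L.nab X Z := by
  refine L.ext_g fun U => ?_
  have h := L.compat X U (Y + Z)
  rw [map_add, L.act_add, L.compat, L.compat, map_add] at h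
  rw [map_add]
  linear_combination -h

theorem nab_smul (X : V) (a : R) (Y : V) : L.nab X (a • Y) = a • L.nab X Y + L.act X a • Y := by
  refine L.ext_g fun U => ?_
  have h := L.compat X U (a • Y)
  rw [map_smul, smul_eq_mul, L.act_mul, L.compat, map_smul, smul_eq_mul] at h
  simp only [map_add, map_smul, smul_eq_mul]
  linear_combination -h

theorem nab_eq (X Y : V) : L.nab X Y = L.nab Y X - L.br Y X := by
  rw [← L.torsion, sub_sub_cancel]

theorem nab_add_left (X Y Z : V) : L.nab (X + Y) Z = L.nab X Z + L.nab Y Z := by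
  rw [L.nab_eq, L.nab_add, L.br_add, L.nab_eq X, L.nab_eq Y]
  abel

theorem nab_smul_left (a : R) (X Y : V) : L.nab (a • X) Y = a • L.nab X Y := by
  rw [L.nab_eq, L.nab_smul, L.br_smul, L.nab_eq X, smul_sub]
  abel

theorem nab_zero (X : V) : L.nab X 0 = 0 := by
  simpa using L.nab_add X 0 0

theorem nab_zero_left (X : V) : L.nab 0 X = 0 := by
  simpa using L.nab_add_left 0 0 X

theorem nab_neg (X Y : V) : L.nab X (-Y) = -L.nab X Y := by
  rw [eq_neg_iff_add_eq_zero, ← L.nab_add, neg_add_cancel, nab_zero]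

theorem nab_sub (X Y Z : V) : L.nab X (Y - Z) = L.nab X Y - L.nab X Z := by
  rw [sub_eq_add_neg, L.nab_add, nab_neg, ← sub_eq_add_neg]

theorem nab_neg_left (X Y : V) : L.nab (-X) Y = -L.nab X Y := by
  rw [eq_neg_iff_add_eq_zero, ← L.nab_add_left, neg_add_cancel, nab_zero_left]

theorem nab_sub_left (X Y Z : V) : L.nab (X - Y) Z = L.nab X Z - L.nab Y Z := by
  rw [sub_eq_add_neg, L.nab_add_left, nab_neg_left, ← sub_eq_add_neg]

theorem nab_sum {ι : Type*} (s : Finset ι) (X : V) (Y : ι → V) :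
    L.nab X (∑ i ∈ s, Y i) = ∑ i ∈ s, L.nab X (Y i) :=
  map_sum (AddMonoidHom.mk' (L.nab X) (L.nab_add X)) Y s

/-- The curvature. -/
def curv (X Y Z : V) : V := L.nab X (L.nab Y Z) - L.nab Y (L.nab X Z) - L.nab (L.br X Y) Z

theorem curv_swap (X Y Z : V) : L.curv X Y Z = -L.curv Y X Z := by
  rw [curv, curv, L.br_swap X Y, nab_neg_left]
  abel

/-- This is the Jacobi identity with every bracket expanded by vanishing torsion. -/
theorem bianchi (X Y Z : V) : L.curv X Y Z + L.curv Y Z X + L.curv Z X Y = 0 := by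
  have j := L.jacobi X Y Z
  have t1 := L.torsion X (L.br Y Z)
  have t2 := L.torsion Y (L.br X Z)
  have t3 := L.torsion (L.br X Y) Z
  have s1 : L.nab X (L.br Y Z) = L.nab X (L.nab Y Z) - L.nab X (L.nab Z Y) := by
    rw [← L.torsion, nab_sub]
  have s2 : L.nab Y (L.br X Z) = L.nab Y (L.nab X Z) - L.nab Y (L.nab Z X) := by
    rw [← L.torsion, nab_sub]
  have s3 : L.nab Z (L.br X Y) = L.nab Z (L.nab X Y) - L.nab Z (L.nab Y X) := by
    rw [← L.torsion, nab_sub]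
  rw [← t1, ← t2, ← t3, s1, s2, s3] at j
  rw [curv, curv, curv, L.br_swap Z X, nab_neg_left]
  rw [← sub_eq_zero] at j
  rw [← j]
  abel

/-- The derivation `[X, Y]` acts on the function `g(Z, W)` as a commutator; expanding both sides by
compatibility leaves the curvature terms. -/
theorem curv_skew (X Y Z W : V) : L.g (L.curv X Y Z) W = -L.g Z (L.curv X Y W) := by
  have h := L.act_br X Y (L.g Z W)
  simp only [L.compat, L.act_add] at h
  simp only [curv, map_sub, LinearMap.sub_apply]
  linear_combination -h

/-- The usual octahedron argument: four Bianchi identities are combined using both skew-symmetries,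
which yields twice the claim. -/
theorem curv_pair [Invertible (2 : R)] (X Y Z W : V) :
    L.g (L.curv X Y Z) W = L.g (L.curv Z W X) Y := by
  have b1 := congrArg (L.g · W) (L.bianchi X Y Z)
  have b2 := congrArg (L.g · X) (L.bianchi Y Z W)
  have b3 := congrArg (L.g · Y) (L.bianchi Z W X)
  have b4 := congrArg (L.g · Z) (L.bianchi W X Y)
  simp only [map_add, LinearMap.add_apply, map_zero, LinearMap.zero_apply] at b1 b2 b3 b4
  have sk : ∀ A B C D, L.g (L.curv A B C) D = -L.g (L.curv A B D) C := fun A B C D => by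
    rw [L.curv_skew, L.g_comm]
  have sw : ∀ A B C D, L.g (L.curv A B C) D = -L.g (L.curv B A C) D := fun A B C D => by
    rw [L.curv_swap]; simp
  refine (isUnit_of_invertible (2 : R)).mul_left_cancel ?_
  have e1 := sk Y Z X W
  have e2 := sk Z W Y X
  have e3 := sk W X Z Y
  have e4 := sk X Y W Z
  have e5 := sw X Z W Y
  have e6 := sk Z X W Y
  have e7 := sw Y W X Z
  have e8 := sk W Y X Z
  linear_combination b1 + b2 - b3 - b4 - e1 - e2 + e3 + e4 + e5 - e6 + e7 - e8

end LeviCivita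

/-- The algebraic data of a weak almost `S`-structure with `£_{ξ_i} Q = 0`. -/
structure LeviCivita.WeakS {R V : Type*} [CommRing R] [AddCommGroup V] [Module R V]
    (L : LeviCivita R V) (ι : Type*) [Fintype ι] [DecidableEq ι] where
  f : V →ₗ[R] V
  Q : V →ₗ[R] V
  ξ : ι → V
  f_sq : ∀ X, f (f X) = -Q X + ∑ i, L.g X (ξ i) • ξ i
  g_ξ : ∀ i j, L.g (ξ i) (ξ j) = if i = j then 1 else 0
  Q_ξ : ∀ i, Q (ξ i) = ξ i
  f_ξ : ∀ i, f (ξ i) = 0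
  f_skew : ∀ X Y, L.g (f X) Y = -L.g X (f Y)
  Q_symm : ∀ X Y, L.g (Q X) Y = L.g X (Q Y)
  f_Q : ∀ X, f (Q X) = Q (f X)
  Q_inj : ∀ X, Q X = 0 → X = 0
  dη : ∀ i X Y, 2 * L.g X (f Y) =
    L.act X (L.g Y (ξ i)) - L.act Y (L.g X (ξ i)) - L.g (L.br X Y) (ξ i)
  lieQ : ∀ i X, L.br (ξ i) (Q X) = Q (L.br (ξ i) X)

/-! ### The tensors `S_i`, closedness of `Φ`, and formula (1). -/

namespace LeviCivita.WeakS

variable {R V : Type*} [CommRing R] [AddCommGroup V] [Module R V]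
  {L : LeviCivita R V} {ι : Type*} [Fintype ι] [DecidableEq ι] (W : L.WeakS ι)

theorem two_cancel [Invertible (2 : R)] {a b : R} (h : 2 * a = 2 * b) : a = b :=
  (isUnit_of_invertible (2 : R)).mul_left_cancel h

/-- The symmetric part `S_i = ∇ξ_i + f` of `∇ξ_i`. -/
def S (i : ι) : V →ₗ[R] V where
  toFun X := L.nab X (W.ξ i) + W.f X
  map_add' X Y := by rw [L.nab_add_left, map_add]; abel
  map_smul' a X := by simp [L.nab_smul_left]

theorem nab_ξ (i : ι) (X : V) : L.nab X (W.ξ i) = W.S i X - W.f X :=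
  (add_sub_cancel_right _ _).symm

theorem S_symm (i : ι) (X Y : V) : L.g (W.S i X) Y = L.g X (W.S i Y) := by
  have h := W.dη i X Y
  rw [L.compat, L.compat, ← L.torsion, map_sub, LinearMap.sub_apply, W.nab_ξ, W.nab_ξ,
    map_sub, map_sub, L.g_comm Y, L.g_comm Y (W.f X), W.f_skew] at h
  linear_combination -h

theorem g_f_ξ (i : ι) (X : V) : L.g (W.f X) (W.ξ i) = 0 := by
  rw [W.f_skew, W.f_ξ, map_zero, neg_zero]

theorem g_Q_ξ (i : ι) (X : V) : L.g (W.Q X) (W.ξ i) = L.g X (W.ξ i) := by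
  rw [W.Q_symm, W.Q_ξ]

/-- The covariant derivative of the fundamental form. -/
def N (X Y Z : V) : R := L.g Y (L.nab X (W.f Z)) - L.g Y (W.f (L.nab X Z))

theorem N_swap (Y Z X : V) : W.N Y Z X = -W.N Y X Z := by
  have h1 := L.compat Y Z (W.f X)
  have h2 := L.compat Y X (W.f Z)
  have h3 : L.act Y (L.g Z (W.f X)) = -L.act Y (L.g X (W.f Z)) := by
    rw [L.g_comm, W.f_skew, eq_neg_iff_add_eq_zero, ← L.act_add, neg_add_cancel, L.act_zero]
  have a1 := W.f_skew (L.nab Y Z) X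
  have a2 := W.f_skew (L.nab Y X) Z
  rw [L.g_comm] at a1 a2
  simp only [N]
  linear_combination -h1 - h2 + h3 - a1 - a2

/-- Closedness of `Φ = dη^i`. Twice `∇Φ` is a skewed second covariant derivative of `ξ_i`, the
symmetric `S_i` dropping out, so the cyclic sum is a Bianchi sum paired with `ξ_i`. -/
theorem N_cyc [Invertible (2 : R)] [Nonempty ι] (X Y Z : V) :
    W.N X Y Z + W.N Y Z X + W.N Z X Y = 0 := by
  obtain ⟨i⟩ := ‹Nonempty ι›
  have key : ∀ X Y Z, 2 * W.N Z X Y =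
      L.g Y (L.nab Z (L.nab X (W.ξ i)) - L.nab (L.nab Z X) (W.ξ i))
        - L.g X (L.nab Z (L.nab Y (W.ξ i)) - L.nab (L.nab Z Y) (W.ξ i)) := by
    intro X Y Z
    simp only [W.nab_ξ, L.nab_sub, map_sub, N]
    have h1 := L.compat Z Y (W.S i X)
    have h2 := L.compat Z X (W.S i Y)
    have h3 := L.compat Z Y (W.f X)
    have h4 := L.compat Z X (W.f Y)
    rw [show L.g Y (W.S i X) = L.g X (W.S i Y) by rw [L.g_comm, W.S_symm]] at h1
    have h5 : L.act Z (L.g Y (W.f X)) = -L.act Z (L.g X (W.f Y)) := by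
      rw [L.g_comm, W.f_skew, eq_neg_iff_add_eq_zero, ← L.act_add, neg_add_cancel, L.act_zero]
    rw [h5, h4] at h3
    rw [h2] at h1
    have a1 := W.S_symm i (L.nab Z Y) X
    have a2 := W.S_symm i (L.nab Z X) Y
    have a3 := W.f_skew (L.nab Z Y) X
    have a4 := W.f_skew (L.nab Z X) Y
    rw [L.g_comm] at a1 a2 a3 a4
    linear_combination h1 - h3 - a1 + a2 - a3 - a4
  have b := congrArg (L.g (W.ξ i)) (L.bianchi X Y Z)
  simp only [map_add, map_zero] at b
  have sk : ∀ A B C, L.g (W.ξ i) (L.curv A B C) = -L.g C (L.curv A B (W.ξ i)) := fun A B C => by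
    rw [L.g_comm, L.curv_skew]
  rw [sk, sk, sk] at b
  apply two_cancel
  rw [mul_add, mul_add, key, key, key]
  simp only [curv, ← L.torsion, L.nab_sub_left, map_sub] at b ⊢
  linear_combination -b

theorem eq_zero_of_f [Nonempty ι] {X : V} (hf : W.f X = 0) (hξ : ∀ i, L.g X (W.ξ i) = 0) :
    X = 0 := by
  refine W.Q_inj X ?_
  have h := W.f_sq X
  simpa [hf, hξ] using h

theorem act_g_ξ (i j : ι) (X : V) : L.act X (L.g (W.ξ i) (W.ξ j)) = 0 := by
  rw [W.g_ξ]
  split_ifs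
  exacts [L.act_one X, L.act_zero X]

theorem N_ξ (X Y : V) (i : ι) : W.N X Y (W.ξ i) = L.g (W.f Y) (L.nab X (W.ξ i)) := by
  rw [N, W.f_ξ, L.nab_zero, map_zero, W.f_skew, zero_sub]

theorem N_ξ_left (X Y : V) (i : ι) : W.N X (W.ξ i) Y = -L.g (L.nab X (W.ξ i)) (W.f Y) := by
  have h := L.compat X (W.ξ i) (W.f Y)
  rw [L.g_comm, W.g_f_ξ, L.act_zero] at h
  rw [N, L.g_comm _ (W.f _), W.g_f_ξ]
  linear_combination -h

variable [Invertible (2 : R)]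

/-- Closedness with two arguments among the `ξ`'s shows that `f` kills the bracket, and `dη^k = Φ`
kills its `ξ_k`-components. -/
theorem br_ξ (i j : ι) : L.br (W.ξ i) (W.ξ j) = 0 := by
  have : Nonempty ι := ⟨i⟩
  refine W.eq_zero_of_f ?_ fun k => ?_
  · refine L.ext_g fun Z => ?_
    have h := W.N_cyc Z (W.ξ j) (W.ξ i)
    rw [W.N_ξ, W.N_ξ, W.N_ξ_left, W.f_ξ, L.g_comm _ (W.f Z)] at h
    simp only [map_zero, LinearMap.zero_apply] at h ⊢
    rw [← L.torsion, map_sub, map_sub]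
    have h1 := W.f_skew Z (L.nab (W.ξ i) (W.ξ j))
    have h2 := W.f_skew Z (L.nab (W.ξ j) (W.ξ i))
    linear_combination -h + h1 - h2
  · have h := W.dη k (W.ξ i) (W.ξ j)
    rw [W.f_ξ, map_zero, W.act_g_ξ, W.act_g_ξ] at h
    linear_combination h

/-- Commuting `ξ`'s make `S_i ξ_j` symmetric in `i, j`, while differentiating the constant `g(ξ_i,
ξ_j)` makes it skew. -/
theorem S_ξ (i j : ι) : W.S i (W.ξ j) = 0 := by
  have hA : ∀ i j, W.S i (W.ξ j) = L.nab (W.ξ j) (W.ξ i) := fun i j => by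
    rw [W.nab_ξ, W.f_ξ, sub_zero]
  have hS : W.S i (W.ξ j) = W.S j (W.ξ i) := by
    rw [hA, hA, ← sub_eq_zero, L.torsion, W.br_ξ]
  refine L.ext_g fun X => two_cancel ?_
  have h := L.compat X (W.ξ i) (W.ξ j)
  rw [W.act_g_ξ, W.nab_ξ, W.nab_ξ, map_sub, LinearMap.sub_apply, map_sub, W.g_f_ξ,
    L.g_comm _ (W.f X), W.g_f_ξ, W.S_symm, L.g_comm _ (W.S j X), W.S_symm, ← hS] at h
  rw [map_zero]
  linear_combination -h

theorem g_S_ξ (i j : ι) (X : V) : L.g (W.S i X) (W.ξ j) = 0 := by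
  rw [W.S_symm, W.S_ξ, map_zero]

theorem nab_ξ_ξ (i j : ι) : L.nab (W.ξ i) (W.ξ j) = 0 := by
  rw [W.nab_ξ, W.S_ξ, W.f_ξ, sub_zero]

/-- The Lie derivative of `f` along `ξ_i` is `-2 S_i f`. -/
theorem lie_f (i : ι) (X : V) :
    L.br (W.ξ i) (W.f X) - W.f (L.br (W.ξ i) X) = -((2 : R) • W.S i (W.f X)) := by
  have : Nonempty ι := ⟨i⟩
  refine L.ext_g fun Z => ?_
  -- Closedness with `ξ_i` in one slot determines `∇_{ξ_i} f`; passing to brackets only adds terms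
  -- in `∇ξ_i = S_i - f`.
  have h := W.N_cyc (W.ξ i) Z X
  rw [W.N_ξ, W.N_ξ_left, N] at h
  simp only [← L.torsion, W.nab_ξ, map_sub, map_neg, map_smul, smul_eq_mul,
    LinearMap.sub_apply] at h ⊢
  have h2 := W.f_skew Z (W.S i X)
  have h5 := W.S_symm i Z (W.f X)
  have h7 := L.g_comm (W.f X) (W.S i Z)
  have h8 := L.g_comm (W.f Z) (W.S i X)
  linear_combination h + h2 - h8 - h5 - h7

theorem two_smul_cancel {X : V} (h : (2 : R) • X = 0) : X = 0 := by
  simpa using congrArg ((⅟(2 : R)) • ·) h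

/-- Here `£_{ξ_i} Q = 0` enters: bracketing with `ξ_i` also respects every `η^j` and `ξ_j`, so it
commutes with `f²`. The Leibniz rule and `lie_f` give the identity. -/
theorem S_f_f (i : ι) (X : V) : W.S i (W.f (W.f X)) + W.f (W.S i (W.f X)) = 0 := by
  have h1 := W.lie_f i (W.f X)
  have h2 := congrArg W.f (W.lie_f i X)
  have h3 : L.br (W.ξ i) (W.f (W.f X)) = W.f (W.f (L.br (W.ξ i) X)) := by
    rw [W.f_sq, W.f_sq, ← W.lieQ]
    simp only [← L.torsion, L.nab_add, L.nab_neg, L.nab_sum, L.nab_add_left, L.nab_neg_left,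
      L.nab_smul, W.nab_ξ_ξ, smul_zero, zero_add]
    have e : ∀ j, L.act (W.ξ i) (L.g X (W.ξ j)) = L.g (L.nab (W.ξ i) X) (W.ξ j) := fun j => by
      rw [L.compat, W.nab_ξ_ξ, map_zero, add_zero]
    have e2 : ∀ j, L.g (L.nab (W.ξ i) X - L.nab X (W.ξ i)) (W.ξ j) =
        L.g (L.nab (W.ξ i) X) (W.ξ j) := fun j => by
      rw [W.nab_ξ, map_sub, LinearMap.sub_apply, map_sub, LinearMap.sub_apply, W.g_S_ξ, W.g_f_ξ,
        sub_self, sub_zero]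
    have e3 : L.nab (∑ j, L.g X (W.ξ j) • W.ξ j) (W.ξ i) = 0 := by
      rw [W.nab_ξ, map_sum, map_sum]
      simp [W.S_ξ, W.f_ξ]
    simp only [e, e2, e3]
    abel
  rw [map_sub, ← h3, map_neg, map_smul] at h2
  refine two_smul_cancel (R := R) ?_
  rw [smul_add, ← neg_eq_zero, neg_add, ← h1, ← h2]
  abel

/-- By `S_f_f` the anticommutator of `S_i` and `f` vanishes on the image of `Q`. It is skew-adjoint,
so taking adjoints moves `Q` to the outside, where injectivity removes it. -/
theorem S_f (i : ι) (X : V) : W.S i (W.f X) = -W.f (W.S i X) := by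
  have hQ : ∀ X, W.S i (W.f (W.Q X)) + W.f (W.S i (W.Q X)) = 0 := fun X => by
    have e : W.Q X = -W.f (W.f X) + ∑ i, L.g X (W.ξ i) • W.ξ i := by rw [W.f_sq]; abel
    have h := W.S_f_f i (W.f X)
    rw [e]
    simp only [map_add, map_neg, map_sum, map_smul, W.S_ξ, W.f_ξ, smul_zero,
      Finset.sum_const_zero, add_zero]
    rw [← neg_add, h, neg_zero]
  rw [eq_neg_iff_add_eq_zero]
  refine W.Q_inj _ (L.ext_g fun Z => ?_)
  have h := congrArg (L.g · X) (hQ Z)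
  simp only [map_add, LinearMap.add_apply, map_zero, LinearMap.zero_apply] at h ⊢
  rw [W.S_symm, W.f_skew, W.f_skew, W.S_symm, W.Q_symm, W.Q_symm] at h
  linear_combination -h

theorem Q_S (i : ι) (X : V) : W.Q (W.S i X) = W.f (W.S i (W.f X)) := by
  have h := W.f_sq (W.S i X)
  simp only [W.g_S_ξ, zero_smul, Finset.sum_const_zero, add_zero] at h
  rw [W.S_f, map_neg, h, neg_neg]

/-- Pair symmetry turns the left side into the curvature operator of `Y, Z` applied to `ξ_i`. The
`S_i` part of `∇ξ_i` gives the last two terms; the `f` part is two derivatives of `Φ`, which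
closedness merges into one. -/
theorem curv_ξ (i : ι) (X Y Z : V) :
    L.g (L.curv (W.ξ i) X Y) Z = -W.N X Y Z
      + L.g X (L.nab Y (W.S i Z) - W.S i (L.nab Y Z))
      - L.g X (L.nab Z (W.S i Y) - W.S i (L.nab Z Y)) := by
  have : Nonempty ι := ⟨i⟩
  have h := W.N_cyc X Y Z
  rw [L.curv_pair, L.g_comm, curv]
  rw [W.N_swap Y Z X] at h
  simp only [N, ← L.torsion, W.nab_ξ, map_sub, L.nab_sub] at h ⊢
  linear_combination h

end LeviCivita.WeakS

/-! ### Rigidity `Q = I` and the tensors in the right-hand sides. -/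

namespace LeviCivita.WeakS

variable {R V : Type*} [CommRing R] [AddCommGroup V] [Module R V]
  {L : LeviCivita R V} {ι : Type*} [Fintype ι] [DecidableEq ι] (W : L.WeakS ι)

theorem N_zero_left (Y Z : V) : W.N 0 Y Z = 0 := by
  simp only [N, L.nab_zero_left, map_zero, sub_zero]

theorem N_zero_mid (X Z : V) : W.N X 0 Z = 0 := by
  simp only [N, map_zero, LinearMap.zero_apply, sub_zero]

theorem N_zero_right (X Y : V) : W.N X Y 0 = 0 := by
  simp only [N, L.nab_zero, map_zero, sub_zero]

/-- If `Q` is parallel along the distribution orthogonal to the `ξ_i`, then `Q` is the identity. -/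
theorem Q_eq_self [Invertible (2 : R)] [Nonempty ι]
    (hQ : ∀ X Y, L.nab (W.f X) (W.Q (W.f Y)) = W.Q (L.nab (W.f X) (W.f Y))) (X : V) :
    W.Q X = X := by
  obtain ⟨i⟩ := ‹Nonempty ι›
  have : Nonempty ι := ⟨i⟩
  have perp : ∀ Y j, L.g (W.Q (W.f Y) - W.f Y) (W.ξ j) = 0 := fun Y j => by
    rw [map_sub, LinearMap.sub_apply, W.g_Q_ξ, sub_self]
  -- With `U = QfY - fY`: both `QfY` and `fY` are orthogonal to `ξ_i`, and so is `Q∇fY - ∇fY`. Hence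
  -- `U` is orthogonal to `∇_{fX} ξ_i = (S_i - f)fX` for all `X`.
  have key : ∀ Y, W.f (W.S i (W.Q (W.f Y) - W.f Y)) + W.f (W.f (W.Q (W.f Y) - W.f Y)) = 0 := by
    intro Y
    refine L.ext_g fun X => ?_
    have h1 := L.compat (W.f X) (W.Q (W.f Y)) (W.ξ i)
    have h2 := L.compat (W.f X) (W.f Y) (W.ξ i)
    rw [W.g_Q_ξ, W.g_f_ξ, L.act_zero] at h1
    rw [W.g_f_ξ, L.act_zero] at h2
    rw [hQ, W.g_Q_ξ] at h1
    have h3 : L.g (W.Q (W.f Y) - W.f Y) (L.nab (W.f X) (W.ξ i)) = 0 := by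
      rw [map_sub, LinearMap.sub_apply]
      linear_combination h2 - h1
    generalize W.Q (W.f Y) - W.f Y = U at h3 ⊢
    rw [W.nab_ξ, map_sub, L.g_comm, W.S_symm, W.f_skew, L.g_comm U, W.f_skew, W.f_skew] at h3
    rw [map_add, map_zero]
    linear_combination -h3
  -- Replacing `Y` by `fY` replaces `U` by `fU`, and anticommutation flips the sign of the `S_i`
  -- term. Adding `f` of the original identity leaves `2f³U = 0`.
  have hf : ∀ Y, W.Q (W.f Y) = W.f Y := by
    intro Y
    have k1 := congrArg W.f (key Y)
    have k2 := key (W.f Y)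
    have e : W.Q (W.f (W.f Y)) - W.f (W.f Y) = W.f (W.Q (W.f Y) - W.f Y) := by
      rw [map_sub, W.f_Q]
    rw [e] at k2
    have p := perp Y
    rw [← sub_eq_zero]
    generalize W.Q (W.f Y) - W.f Y = U at k1 k2 p ⊢
    rw [W.S_f, map_neg] at k2
    rw [map_add, map_zero] at k1
    have k3 : W.f (W.f (W.f U)) = 0 := by
      refine two_smul_cancel (R := R) ?_
      rw [two_smul]
      calc _ = (W.f (W.f (W.S i U)) + W.f (W.f (W.f U)))
            + (-W.f (W.f (W.S i U)) + W.f (W.f (W.f U))) := by abel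
        _ = 0 := by rw [k1, k2, add_zero]
    have k4 := W.eq_zero_of_f k3 (W.g_f_ξ · _)
    exact W.eq_zero_of_f (W.eq_zero_of_f k4 (W.g_f_ξ · _)) p
  rw [← sub_eq_zero]
  refine W.Q_inj _ ?_
  have h := hf (W.f X)
  rw [W.f_sq] at h
  simp only [map_add, map_neg, map_sum, map_smul, W.Q_ξ, add_left_inj, neg_inj] at h
  rw [map_sub, h, sub_self]

/-- `η̄ = ∑ η^j`. -/
def etaBar (X : V) : R := ∑ j, L.g X (W.ξ j)

/-- `∑ η^j(Y) g(S_j X, Z)`. -/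
def σ (Y X Z : V) : R := ∑ j, L.g Y (W.ξ j) * L.g (W.S j X) Z

theorem σ_comm (Y X Z : V) : W.σ Y X Z = W.σ Y Z X := by
  simp only [σ]
  exact Finset.sum_congr rfl fun j _ => by rw [W.S_symm, L.g_comm X]

theorem sum_g_nab_ξ (Y X Z : V) : ∑ j, L.g Y (W.ξ j) * L.g (L.nab X (W.ξ j)) Z =
    W.σ Y X Z - W.etaBar Y * L.g (W.f X) Z := by
  simp only [W.nab_ξ, σ, etaBar, map_sub, LinearMap.sub_apply, mul_sub, Finset.sum_sub_distrib,
    Finset.sum_mul]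

theorem etaBar_of_perp {Y : V} (h : ∀ i, L.g Y (W.ξ i) = 0) : W.etaBar Y = 0 :=
  Finset.sum_eq_zero fun i _ => h i

theorem σ_of_perp {Y : V} (h : ∀ i, L.g Y (W.ξ i) = 0) (X Z : V) : W.σ Y X Z = 0 :=
  Finset.sum_eq_zero fun i _ => by rw [h, zero_mul]

theorem σ_f [Invertible (2 : R)] (Y X Z : V) : W.σ Y (W.f X) Z = W.σ Y X (W.f Z) := by
  simp only [σ]
  refine Finset.sum_congr rfl fun j _ => ?_
  rw [W.S_f, map_neg, LinearMap.neg_apply, W.f_skew, neg_neg]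

/-! ### Identities for `Q = I`, leading to formulas (2) and (3). -/

section

variable (hQ : ∀ X, W.Q X = X)

include hQ

theorem f_sq' (X : V) : W.f (W.f X) = -X + ∑ i, L.g X (W.ξ i) • W.ξ i := by
  rw [W.f_sq, hQ]

/-- The covariant derivative of `f² = -I + ∑ η^j ⊗ ξ_j`. -/
theorem N_f (X Y Z : V) : W.N X Y (W.f Z) = W.N X (W.f Y) Z
    + (W.σ Y X Z - W.etaBar Y * L.g (W.f X) Z) + (W.σ Z X Y - W.etaBar Z * L.g (W.f X) Y) := by
  have e : L.g Y (L.nab X (W.f (W.f Z))) = -L.g Y (L.nab X Z)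
      + ∑ j, L.g Z (W.ξ j) * L.g (L.nab X (W.ξ j)) Y
      + ∑ j, (L.g (L.nab X Z) (W.ξ j) + L.g (L.nab X (W.ξ j)) Z) * L.g Y (W.ξ j) := by
    rw [W.f_sq' hQ, L.nab_add, L.nab_neg, L.nab_sum, map_add, map_neg, map_sum, add_assoc,
      ← Finset.sum_add_distrib]
    congr 1
    refine Finset.sum_congr rfl fun j _ => ?_
    rw [L.nab_smul, L.compat, map_add, map_smul, map_smul, smul_eq_mul, smul_eq_mul,
      L.g_comm Y (L.nab X (W.ξ j)), L.g_comm Z (L.nab X (W.ξ j))]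
  have e2 : L.g (W.f Y) (W.f (L.nab X Z)) = L.g Y (L.nab X Z)
      - ∑ j, L.g (L.nab X Z) (W.ξ j) * L.g Y (W.ξ j) := by
    rw [W.f_skew, W.f_sq' hQ, map_add, map_neg, map_sum]
    simp only [map_smul, smul_eq_mul]
    ring
  have e3 := W.f_skew Y (L.nab X (W.f Z))
  simp only [add_mul, Finset.sum_add_distrib] at e
  rw [← W.sum_g_nab_ξ, ← W.sum_g_nab_ξ, N, N, e, e2]
  simp only [mul_comm (L.g (L.nab X (W.ξ _)) Z)]
  linear_combination -e3

theorem N_f_f (X Y Z : V) : W.N X (W.f Y) (W.f Z) = -W.N X Y Z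
    - (W.σ Y X (W.f Z) - W.etaBar Y * L.g (W.f X) (W.f Z))
    + (W.σ Z X (W.f Y) - W.etaBar Z * L.g (W.f X) (W.f Y)) := by
  have e : W.N X (W.f (W.f Y)) Z = -W.N X Y Z - ∑ j, L.g Y (W.ξ j) *
      L.g (L.nab X (W.ξ j)) (W.f Z) := by
    have h : ∀ j, L.g Y (W.ξ j) * L.g (L.nab X (W.ξ j)) (W.f Z) =
        -(L.g Y (W.ξ j) * W.N X (W.ξ j) Z) := fun j => by rw [W.N_ξ_left]; ring
    simp only [h, N, W.f_sq' hQ, map_add, map_neg, map_sum, map_smul, LinearMap.add_apply,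
      LinearMap.neg_apply, LinearMap.sum_apply, LinearMap.smul_apply, smul_eq_mul, mul_sub,
      Finset.sum_neg_distrib, Finset.sum_sub_distrib]
    ring
  rw [W.N_f hQ, W.σ_of_perp (W.g_f_ξ · Y), W.etaBar_of_perp (W.g_f_ξ · Y), e, W.sum_g_nab_ξ]
  ring

variable [Invertible (2 : R)] [Nonempty ι]

/-- Formula (3) paired with a test field `Z`. -/
theorem N_add_N_f (X Y Z : V) : W.N X Z Y + W.N (W.f X) Z (W.f Y) =
    2 * L.g (W.f X) (W.f Y) * W.etaBar Z - W.etaBar Y * L.g (W.f X) (W.f Z)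
      + W.σ Y X (W.f Z) := by
  -- Closedness is added at `(X, Y, Z)` and `(fX, fY, Z)`; by `N_f_f` the derivatives of `Φ` along
  -- `Z` cancel.
  have half : ∀ X Y Z, W.N X Y Z + W.N (W.f X) (W.f Y) Z + W.N Y Z X + W.N (W.f Y) (W.f Z) X =
      -W.σ Z Y (W.f X) - W.σ Y Z (W.f X) - W.etaBar Z * L.g (W.f X) (W.f Y)
        - 2 * W.etaBar X * L.g (W.f Y) (W.f Z) + W.etaBar Y * L.g (W.f X) (W.f Z) := by
    intro X Y Z
    have c1 := W.N_cyc X Y Z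
    have c2 := W.N_cyc (W.f X) (W.f Y) Z
    have e2 := W.N_f_f hQ Z X Y
    have e1 := W.N_f hQ (W.f Y) Z X
    have s1 := W.f_skew (W.f Y) X
    have s2 := W.f_skew (W.f Y) Z
    have t1 := W.σ_comm X (W.f Y) Z
    have t2 := W.σ_f Z Y X
    have g1 := L.g_comm (W.f X) (W.f Y)
    have g2 := L.g_comm (W.f X) (W.f Z)
    have g3 := L.g_comm (W.f Y) (W.f Z)
    linear_combination c1 + c2 - e2 - e1 - t1 - t2 + W.etaBar Z * (s1 + g1)
      + W.etaBar X * (s2 + g3) - W.etaBar Y * g2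
  -- With `a(X,Y,Z) = N X Y Z + N (fX) (fY) Z`, `half` gives the sums of consecutive cyclic
  -- rotations of `a`. Solving for `a` alone produces the factor 2.
  refine two_cancel ?_
  have h1 := half X Y Z
  have h2 := half Y Z X
  have h3 := half Z X Y
  have n1 := W.N_swap X Y Z
  have n2 := W.N_swap (W.f X) (W.f Y) Z
  have t1 : W.σ Z Y (W.f X) = W.σ Z X (W.f Y) := by rw [W.σ_comm, W.σ_f]
  have t2 : W.σ Y Z (W.f X) = W.σ Y X (W.f Z) := by rw [W.σ_comm, W.σ_f]
  have t3 : W.σ X Z (W.f Y) = W.σ X Y (W.f Z) := by rw [W.σ_comm, W.σ_f]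
  have g1 := L.g_comm (W.f X) (W.f Y)
  have g2 := L.g_comm (W.f X) (W.f Z)
  have g3 := L.g_comm (W.f Y) (W.f Z)
  linear_combination h2 - h1 - h3 + 2 * n1 + 2 * n2 + t1 + t2 - t3 + W.etaBar X * g3
    + W.etaBar Y * g2 - W.etaBar Z * g1

omit [Nonempty ι] hQ in
/-- The interaction of the covariant derivative of `S_i` with `f`. -/
theorem nab_S_f (i : ι) (Y X Z : V) :
    L.g X (L.nab Y (W.S i (W.f Z)) - W.S i (L.nab Y (W.f Z))) =
      L.g (W.f X) (L.nab Y (W.S i Z) - W.S i (L.nab Y Z))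
        - W.N Y (W.S i X) Z - W.N Y X (W.S i Z) := by
  have h1 := W.f_skew X (L.nab Y (W.S i Z))
  have h2 := W.S_symm i X (L.nab Y (W.f Z))
  have h3 := W.S_symm i X (W.f (L.nab Y Z))
  have h4 := W.f_skew X (W.S i (L.nab Y Z))
  rw [W.S_f, map_neg] at h3
  simp only [N, map_sub, W.S_f, L.nab_neg, map_neg]
  linear_combination h2 - h3 - h1 + h4

/-- These are the `∇S_i` terms that `curv_ξ` contributes to (2), up to exchanging `Y` and `Z`.
Moving `f` across by `nab_S_f` and using `f² = -I` off the `ξ`'s cancels them, leaving derivatives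
of `Φ`. -/
theorem nab_S_add (i : ι) (Y X Z : V) :
    L.g X (L.nab Y (W.S i Z) - W.S i (L.nab Y Z))
      + L.g (W.f X) (L.nab Y (W.S i (W.f Z)) - W.S i (L.nab Y (W.f Z)))
      - L.g X (L.nab (W.f Y) (W.S i (W.f Z)) - W.S i (L.nab (W.f Y) (W.f Z)))
      + L.g (W.f X) (L.nab (W.f Y) (W.S i Z) - W.S i (L.nab (W.f Y) Z)) =
    2 * W.N Y (W.f (W.S i X)) Z + 2 * W.etaBar Z * L.g Y (W.f (W.S i X))
      - 2 * W.etaBar X * L.g Y (W.f (W.S i Z)) := by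
  have ff : ∀ X, W.f (W.f (W.S i X)) = -W.S i X := fun X => by
    simp [W.f_sq' hQ, W.g_S_ξ]
  have e1 := W.nab_S_f i Y (W.f X) Z
  have e2 := W.nab_S_f i (W.f Y) X Z
  have e3 : L.g (W.f (W.f X)) (L.nab Y (W.S i Z) - W.S i (L.nab Y Z)) =
      -L.g X (L.nab Y (W.S i Z) - W.S i (L.nab Y Z))
        - (W.σ X Y (W.S i Z) - W.etaBar X * L.g (W.f Y) (W.S i Z)) := by
    have h : ∀ j, L.g (W.ξ j) (L.nab Y (W.S i Z) - W.S i (L.nab Y Z)) =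
        -L.g (L.nab Y (W.ξ j)) (W.S i Z) := fun j => by
      have c := L.compat Y (W.ξ j) (W.S i Z)
      rw [L.g_comm, W.g_S_ξ, L.act_zero] at c
      rw [map_sub, L.g_comm _ (W.S i (L.nab Y Z)), W.g_S_ξ]
      linear_combination -c
    rw [← W.sum_g_nab_ξ, W.f_sq' hQ]
    simp only [map_add, map_neg, map_sum, LinearMap.add_apply, LinearMap.neg_apply,
      LinearMap.sum_apply, map_smul, LinearMap.smul_apply, smul_eq_mul, h, mul_neg,
      Finset.sum_neg_distrib]
    ring
  have e4 := W.N_f_f hQ Y X (W.f (W.S i Z))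
  have e5 := W.N_add_N_f hQ Y (W.f (W.S i Z)) X
  have e6 := W.N_add_N_f hQ Y (W.f (W.S i X)) Z
  have z1 : ∀ X, W.etaBar (W.f X) = 0 := fun X => W.etaBar_of_perp (W.g_f_ξ · X)
  have z2 : ∀ X Y Z, W.σ (W.f X) Y Z = 0 := fun X => W.σ_of_perp (W.g_f_ξ · X)
  have n3 := W.N_swap Y Z (W.f (W.S i X))
  have n4 := W.N_swap (W.f Y) Z (W.S i X)
  have gf : ∀ X, L.g (W.f Y) (W.S i X) = -L.g Y (W.f (W.S i X)) := fun X => W.f_skew _ _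
  have nn : ∀ A B C, W.N A B (-C) = -W.N A B C := fun A B C => by
    simp only [N, map_neg, L.nab_neg]; ring
  have nn' : ∀ A B C, W.N A (-B) C = -W.N A B C := fun A B C => by
    simp only [N, map_neg, LinearMap.neg_apply]; ring
  have sn : ∀ A B C, W.σ A B (-C) = -W.σ A B C := fun A B C => by
    simp only [σ, map_neg, mul_neg, Finset.sum_neg_distrib]
  simp only [ff, z1, z2, map_neg, nn, nn', sn, W.S_f] at e1 e2 e3 e4 e5 e6
  rw [gf] at e3 e4 e5 e6
  simp only [W.S_f]
  linear_combination e1 - e2 + e3 + e4 - e5 + e6 - n3 + n4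

theorem curv_ξ_sum (i : ι) (X Y Z : V) :
    L.g (L.curv (W.ξ i) X Y) Z - L.g (L.curv (W.ξ i) X (W.f Y)) (W.f Z)
      + L.g (L.curv (W.ξ i) (W.f X) Y) (W.f Z) + L.g (L.curv (W.ξ i) (W.f X) (W.f Y)) Z =
    2 * W.N (W.f (W.S i X)) Y Z
      + 2 * W.etaBar Z * (L.g (W.f X) (W.f Y) + L.g (W.f (W.S i X)) Y)
      - 2 * W.etaBar Y * (L.g (W.f X) (W.f Z) + L.g (W.f (W.S i X)) Z) := by
  have a1 := W.nab_S_add hQ i Y X Z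
  have a2 := W.nab_S_add hQ i Z X Y
  have e1 := W.N_f_f hQ X Y Z
  have e2 := W.N_add_N_f hQ X Y Z
  have e3 := W.N_add_N_f hQ X Z Y
  have n1 := W.N_swap X Y Z
  have n2 := W.N_swap (W.f X) (W.f Y) Z
  have n3 := W.N_swap Y Z (W.f (W.S i X))
  have c := W.N_cyc (W.f (W.S i X)) Y Z
  have s : L.g Y (W.f (W.S i Z)) = L.g Z (W.f (W.S i Y)) := by
    have h1 := W.f_skew Y (W.S i Z)
    have h2 := W.S_symm i (W.f Y) Z
    rw [W.S_f, map_neg, LinearMap.neg_apply, L.g_comm] at h2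
    linear_combination h1 + h2
  have g1 := L.g_comm Y (W.f (W.S i X))
  have g2 := L.g_comm Z (W.f (W.S i X))
  rw [W.curv_ξ, W.curv_ξ, W.curv_ξ, W.curv_ξ]
  linear_combination a1 - a2 + e1 + e2 - e3 - 2 * c + 2 * n3 - n1 - n2 + 2 * W.etaBar Z * g1
    - 2 * W.etaBar X * s - 2 * W.etaBar Y * g2

end

end LeviCivita.WeakS

/-! ### Smoothness of the Levi-Civita derivative. -/

namespace WeakF

section Smoothness

variable {E : Type*} [NormedAddCommGroup E] [NormedSpace ℝ E]
  {M : Type*} [TopologicalSpace M] [ChartedSpace E M] [IsManifold 𝓘(ℝ, E) ∞ M]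

theorem contMDiffAt_dirDeriv {X : VField E M} {φ : M → ℝ} {x : M}
    (hX : ContMDiffAt 𝓘(ℝ, E) 𝓘(ℝ, E).tangent ∞
      (fun x => (⟨x, X x⟩ : TangentBundle 𝓘(ℝ, E) M)) x)
    (hφ : ContMDiffAt 𝓘(ℝ, E) 𝓘(ℝ, ℝ) ∞ φ x) :
    ContMDiffAt 𝓘(ℝ, E) 𝓘(ℝ, ℝ) ∞ (dirDeriv X φ) x := by
  have h1 := hφ.mfderiv_const (m := ∞) (by simp)
  have h2 := ContMDiffAt.clm_apply_of_inCoordinates (b₁ := id) (b₂ := φ)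
    (ϕ := fun m => mfderiv 𝓘(ℝ, E) 𝓘(ℝ, ℝ) φ m) h1 hX hφ
  rw [contMDiffAt_totalSpace] at h2
  simpa using! h2.2

theorem contMDiffAt_bracket [CompleteSpace E] {X Y : VField E M} {x : M}
    (hX : ContMDiffAt 𝓘(ℝ, E) 𝓘(ℝ, E).tangent ∞
      (fun x => (⟨x, X x⟩ : TangentBundle 𝓘(ℝ, E) M)) x)
    (hY : ContMDiffAt 𝓘(ℝ, E) 𝓘(ℝ, E).tangent ∞
      (fun x => (⟨x, Y x⟩ : TangentBundle 𝓘(ℝ, E) M)) x) :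
    ContMDiffAt 𝓘(ℝ, E) 𝓘(ℝ, E).tangent ∞
      (fun x => (⟨x, bracket X Y x⟩ : TangentBundle 𝓘(ℝ, E) M)) x := by
  have : IsManifold 𝓘(ℝ, E) (minSmoothness ℝ 2) M :=
    IsManifold.of_le (n := ∞) (by rw [minSmoothness_of_isRCLikeNormedField]; exact ENat.LEInfty.out)
  have : IsManifold 𝓘(ℝ, E) ((⊤ : ℕ∞) + 1) M := ‹IsManifold 𝓘(ℝ, E) ∞ M›
  exact ContMDiffAt.mlieBracket_vectorField (m := ⊤) (n := ⊤) hX hY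
    (by rw [minSmoothness_of_isRCLikeNormedField]; rfl)

variable [RiemannianBundle (fun x : M => TangentSpace 𝓘(ℝ, E) x)]
  [IsContMDiffRiemannianBundle 𝓘(ℝ, E) ∞ E (fun x : M => TangentSpace 𝓘(ℝ, E) x)]

theorem contMDiffAt_metric {X Y : VField E M} {x : M}
    (hX : ContMDiffAt 𝓘(ℝ, E) 𝓘(ℝ, E).tangent ∞
      (fun x => (⟨x, X x⟩ : TangentBundle 𝓘(ℝ, E) M)) x)
    (hY : ContMDiffAt 𝓘(ℝ, E) 𝓘(ℝ, E).tangent ∞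
      (fun x => (⟨x, Y x⟩ : TangentBundle 𝓘(ℝ, E) M)) x) :
    ContMDiffAt 𝓘(ℝ, E) 𝓘(ℝ, ℝ) ∞ (metric X Y) x :=
  ContMDiffAt.inner_bundle (F := E) (E := fun x : M => TangentSpace 𝓘(ℝ, E) x) (b := id) hX hY

variable [FiniteDimensional ℝ E]

/-- A vector field is smooth at a point when its inner products with the fields of a local frame
are. -/
theorem contMDiffAt_of_metric_frame {V : VField E M} {x₀ : M}
    (h : ∀ i, ContMDiffAt 𝓘(ℝ, E) 𝓘(ℝ, ℝ) ∞ (metric V ((trivializationAt E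
      (TangentSpace 𝓘(ℝ, E) (M := M)) x₀).localFrame (Module.finBasis ℝ E) i)) x₀) :
    ContMDiffAt 𝓘(ℝ, E) 𝓘(ℝ, E).tangent ∞
      (fun x => (⟨x, V x⟩ : TangentBundle 𝓘(ℝ, E) M)) x₀ := by
  set e := trivializationAt E (TangentSpace 𝓘(ℝ, E) (M := M)) x₀ with he
  set b := Module.finBasis ℝ E
  have hx₀ : x₀ ∈ e.baseSet := FiberBundle.mem_baseSet_trivializationAt' x₀
  -- The Gram matrix of the local frame. It is invertible over the base set, and its inverse turns
  -- the inner products of `V` with the frame into the coefficients of `V`.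
  let G : M → (Fin (Module.finrank ℝ E) → ℝ) →L[ℝ] (Fin (Module.finrank ℝ E) → ℝ) := fun x =>
    ∑ i, ∑ j, metric (e.localFrame b i) (e.localFrame b j) x •
      (ContinuousLinearMap.proj j : (Fin (Module.finrank ℝ E) → ℝ) →L[ℝ] ℝ).smulRight
        (Pi.single i (1 : ℝ))
  have hG : ∀ x c i, G x c i = inner ℝ (∑ j, c j • e.localFrame b j x) (e.localFrame b i x) := by
    intro x c i
    simp [G, metric, sum_inner, inner_smul_left, Finset.sum_apply, Pi.single_apply,
      real_inner_comm, mul_comm]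
  have hGs : ContMDiffAt 𝓘(ℝ, E) 𝓘(ℝ, (Fin (Module.finrank ℝ E) → ℝ) →L[ℝ]
      (Fin (Module.finrank ℝ E) → ℝ)) ∞ G x₀ := by
    refine ContMDiffAt.sum fun i _ => ContMDiffAt.sum fun j _ => ?_
    exact (contMDiffAt_metric (contMDiffAt_localFrame_of_mem _ _ b i hx₀)
      (contMDiffAt_localFrame_of_mem _ _ b j hx₀)).smul contMDiffAt_const
  have hinj : ∀ x ∈ e.baseSet, Function.Injective (G x) := by
    intro x hx
    refine (injective_iff_map_eq_zero (G x)).2 fun c hc => ?_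
    have h0 : ∑ j, c j • e.localFrame b j x = 0 := by
      rw [← inner_self_eq_zero (𝕜 := ℝ)]
      conv_lhs => rw [inner_sum]
      refine Finset.sum_eq_zero fun i _ => ?_
      rw [inner_smul_right, ← hG, hc]
      simp
    simp only [e.localFrame_apply_of_mem_baseSet b hx] at h0
    exact funext (Fintype.linearIndependent_iff.1 (e.basisAt b hx).linearIndependent c h0)
  let Ge : ∀ x ∈ e.baseSet, (Fin (Module.finrank ℝ E) → ℝ) ≃L[ℝ] (Fin (Module.finrank ℝ E) → ℝ) :=
    fun x hx => (LinearEquiv.ofInjectiveEndo (G x).toLinearMap (hinj x hx)).toContinuousLinearEquiv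
  have hGe : ∀ x hx, (Ge x hx : _ →L[ℝ] _) = G x := fun x hx => by
    ext; rfl
  have hinv : ContMDiffAt 𝓘(ℝ, E) 𝓘(ℝ, (Fin (Module.finrank ℝ E) → ℝ) →L[ℝ]
      (Fin (Module.finrank ℝ E) → ℝ)) ∞ (fun x => (G x).inverse) x₀ := by
    have h1 : ContDiffAt ℝ ∞ ContinuousLinearMap.inverse (G x₀) := by
      rw [← hGe x₀ hx₀]
      exact contDiffAt_map_inverse _
    exact h1.contMDiffAt.comp x₀ hGs
  have hb : ContMDiffAt 𝓘(ℝ, E) 𝓘(ℝ, Fin (Module.finrank ℝ E) → ℝ) ∞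
      (fun x i => metric V (e.localFrame b i) x) x₀ := contMDiffAt_pi_space.2 h
  have hc := hinv.clm_apply hb
  rw [contMDiffAt_pi_space] at hc
  refine (contMDiffAt_iff_localFrameCoeff b hx₀).2 fun i => ?_
  refine (hc i).congr_of_eventuallyEq ?_
  filter_upwards [e.open_baseSet.mem_nhds hx₀] with x hx
  have hV := e.eq_sum_localFrameCoeff_smul (I := 𝓘(ℝ, E)) (b := b) (s := V) hx
  have hGx : (fun i => metric V (e.localFrame b i) x) =
      G x (fun i => LinearMap.piApply (e.localFrameCoeff 𝓘(ℝ, E) b i) V x) := by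
    funext k
    rw [hG, metric]
    congr 1
  rw [hGx, ← hGe x hx, ContinuousLinearMap.inverse_equiv]
  simp

theorem IsSmoothVF.nabla {X Y : VField E M} (hX : IsSmoothVF X) (hY : IsSmoothVF Y) :
    IsSmoothVF (nabla X Y) := by
  intro x₀
  refine contMDiffAt_of_metric_frame fun i => ?_
  set e := trivializationAt E (TangentSpace 𝓘(ℝ, E) (M := M)) x₀
  set Z := e.localFrame (Module.finBasis ℝ E) i
  have hx₀ : x₀ ∈ e.baseSet := FiberBundle.mem_baseSet_trivializationAt' x₀
  have hZ : ∀ x ∈ e.baseSet, ContMDiffAt 𝓘(ℝ, E) 𝓘(ℝ, E).tangent ∞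
      (fun x => (⟨x, Z x⟩ : TangentBundle 𝓘(ℝ, E) M)) x := fun x hx =>
    contMDiffAt_localFrame_of_mem _ _ _ i hx
  have hk : ContMDiffAt 𝓘(ℝ, E) 𝓘(ℝ, ℝ) ∞ (fun x => (1 / 2 : ℝ) * koszul X Y Z x) x₀ := by
    refine contMDiffAt_const.mul ?_
    have hZ0 := hZ x₀ hx₀
    have hX0 := hX x₀
    have hY0 := hY x₀
    exact (((((contMDiffAt_dirDeriv hX0 (contMDiffAt_metric hY0 hZ0)).add
      (contMDiffAt_dirDeriv hY0 (contMDiffAt_metric hZ0 hX0))).sub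
      (contMDiffAt_dirDeriv hZ0 (contMDiffAt_metric hX0 hY0))).add
      (contMDiffAt_metric (contMDiffAt_bracket hX0 hY0) hZ0)).sub
      (contMDiffAt_metric (contMDiffAt_bracket hX0 hZ0) hY0)).sub
      (contMDiffAt_metric (contMDiffAt_bracket hY0 hZ0) hX0)
  refine hk.congr_of_eventuallyEq ?_
  filter_upwards [e.open_baseSet.mem_nhds hx₀] with x hx
  rw [← two_mul_metric_nabla ((hX x).mdifferentiableAt (by simp))
    ((hY x).mdifferentiableAt (by simp)) ((hZ x hx).mdifferentiableAt (by simp))]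
  ring

end Smoothness

end WeakF

/-! ### Smooth vector fields as a Lie–Rinehart algebra. -/

namespace WeakF

section Derivations

variable {E : Type*} [NormedAddCommGroup E] [NormedSpace ℝ E]
  {M : Type*} [TopologicalSpace M] [ChartedSpace E M]

theorem dirDeriv_add {φ ψ : M → ℝ} (X : VField E M) {x : M} (hφ : MDiffAt φ x)
    (hψ : MDiffAt ψ x) :
    dirDeriv X (fun y => φ y + ψ y) x = dirDeriv X φ x + dirDeriv X ψ x := by
  rw [dirDeriv, mvfderiv_fun_add hφ hψ]
  rfl

theorem dirDeriv_mul {φ ψ : M → ℝ} (X : VField E M) {x : M} (hφ : MDiffAt φ x)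
    (hψ : MDiffAt ψ x) :
    dirDeriv X (fun y => φ y * ψ y) x = φ x * dirDeriv X ψ x + ψ x * dirDeriv X φ x := by
  simp [dirDeriv, mvfderiv_fun_mul hφ hψ]

variable (E M) in
/-- The smooth functions on `M`. -/
abbrev SmoothFun := C^∞⟮𝓘(ℝ, E), M; 𝓘(ℝ, ℝ), ℝ⟯

theorem two_apply (x : M) : (2 : SmoothFun E M) x = 2 := by
  rw [← one_add_one_eq_two, ← one_add_one_eq_two]
  rfl

end Derivations

section Sections

variable (E : Type*) [NormedAddCommGroup E] [NormedSpace ℝ E]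
  (M : Type*) [TopologicalSpace M] [ChartedSpace E M] [IsManifold 𝓘(ℝ, E) ∞ M]

/-- The additive group of smooth vector fields on `M`. -/
def smoothFields : AddSubgroup (VField E M) where
  carrier := {X | IsSmoothVF X}
  add_mem' hX hY := ContMDiff.add_section hX hY
  zero_mem' := contMDiff_zeroSection ℝ (TangentSpace 𝓘(ℝ, E) (M := M))
  neg_mem' hX := ContMDiff.neg_section hX

variable {E M}

instance : Module (SmoothFun E M) (smoothFields E M) where
  smul a X := ⟨fun x => a x • X.1 x, ContMDiff.smul_section a.contMDiff X.2⟩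
  one_smul X := Subtype.ext (funext fun x => one_smul ℝ (X.1 x))
  mul_smul a b X := Subtype.ext (funext fun x => mul_smul (a x) (b x) (X.1 x))
  smul_zero a := Subtype.ext (funext fun x => smul_zero (a x))
  smul_add a X Y := Subtype.ext (funext fun x => smul_add (a x) (X.1 x) (Y.1 x))
  add_smul a b X := Subtype.ext (funext fun x => add_smul (a x) (b x) (X.1 x))
  zero_smul X := Subtype.ext (funext fun x => zero_smul ℝ (X.1 x))

theorem smul_val (a : SmoothFun E M) (X : smoothFields E M) :
    (a • X).1 = fun x => a x • X.1 x := rfl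

instance : Invertible (2 : SmoothFun E M) where
  invOf := ⟨fun _ => 2⁻¹, contMDiff_const⟩
  invOf_mul_self := by
    ext x
    change (2⁻¹ : ℝ) * (2 : SmoothFun E M) x = 1
    rw [two_apply, inv_mul_cancel₀ two_ne_zero]
  mul_invOf_self := by
    ext x
    change (2 : SmoothFun E M) x * (2⁻¹ : ℝ) = 1
    rw [two_apply, mul_inv_cancel₀ two_ne_zero]

theorem IsSmoothVF.mdifferentiableAt {X : VField E M} (hX : IsSmoothVF X) (x : M) :
    MDiffAt (T% X) x :=
  (hX x).mdifferentiableAt (by simp)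

theorem contMDiff_dirDeriv {X : VField E M} {φ : M → ℝ} (hX : IsSmoothVF X)
    (hφ : ContMDiff 𝓘(ℝ, E) 𝓘(ℝ, ℝ) ∞ φ) : ContMDiff 𝓘(ℝ, E) 𝓘(ℝ, ℝ) ∞ (dirDeriv X φ) :=
  fun x => contMDiffAt_dirDeriv (hX x) (hφ x)

variable [CompleteSpace E]

theorem bracket_smul (X : VField E M) {Y : VField E M} {φ : M → ℝ} {x : M} (hφ : MDiffAt φ x)
    (hY : MDiffAt (T% Y) x) :
    bracket X (fun y => φ y • Y y) x = φ x • bracket X Y x + dirDeriv X φ x • Y x := by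
  rw [add_comm]
  exact VectorField.mlieBracket_smul_right hφ hY

theorem bracket_add (X : VField E M) {Y Z : VField E M} {x : M}
    (hY : MDiffAt (T% Y) x) (hZ : MDiffAt (T% Z) x) :
    bracket X (Y + Z) x = bracket X Y x + bracket X Z x :=
  VectorField.mlieBracket_add_right hY hZ

theorem bracket_jacobi {X Y Z : VField E M} (hX : IsSmoothVF X) (hY : IsSmoothVF Y)
    (hZ : IsSmoothVF Z) :
    bracket X (bracket Y Z) = bracket (bracket X Y) Z + bracket Y (bracket X Z) := by
  have h2 : minSmoothness ℝ 2 ≤ ∞ := by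
    rw [minSmoothness_of_isRCLikeNormedField]; exact ENat.LEInfty.out
  have h3 : minSmoothness ℝ 3 ≤ ∞ := by
    rw [minSmoothness_of_isRCLikeNormedField]; exact ENat.LEInfty.out
  have : IsManifold 𝓘(ℝ, E) (minSmoothness ℝ 3) M := IsManifold.of_le h3
  exact VectorField.leibniz_identity_mlieBracket (hX.of_le h2) (hY.of_le h2) (hZ.of_le h2)

theorem IsSmoothVF.bracket {X Y : VField E M} (hX : IsSmoothVF X) (hY : IsSmoothVF Y) :
    IsSmoothVF (bracket X Y) :=
  fun x => contMDiffAt_bracket (hX x) (hY x)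

/-- Expanding the Jacobi identity for `X, Y, φZ` and subtracting `φ` times the one for `X, Y, Z`
leaves the claim multiplied by `Z`. In the application `Z` is some `ξ_i`, which vanishes nowhere. -/
theorem dirDeriv_bracket {X Y Z : VField E M} (hX : IsSmoothVF X) (hY : IsSmoothVF Y)
    (hZ : IsSmoothVF Z) {φ : M → ℝ} (hφ : ContMDiff 𝓘(ℝ, E) 𝓘(ℝ, ℝ) ∞ φ) {x : M}
    (hx : Z x ≠ 0) :
    dirDeriv (WeakF.bracket X Y) φ x = dirDeriv X (dirDeriv Y φ) x - dirDeriv Y (dirDeriv X φ) x := by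
  have dφ : ∀ {ψ : M → ℝ}, ContMDiff 𝓘(ℝ, E) 𝓘(ℝ, ℝ) ∞ ψ → ∀ y, MDiffAt ψ y := fun h y =>
    (h y).mdifferentiableAt (by simp)
  have step : ∀ {U : VField E M}, IsSmoothVF U → ∀ {ψ : M → ℝ}, ContMDiff 𝓘(ℝ, E) 𝓘(ℝ, ℝ) ∞ ψ →
      ∀ (X : VField E M), WeakF.bracket X (fun y => ψ y • U y) =
        (fun y => ψ y • WeakF.bracket X U y) + fun y => dirDeriv X ψ y • U y :=
    fun hU ψ hψ X => funext fun y => bracket_smul X (dφ hψ y) (hU.mdifferentiableAt y)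
  have sm : ∀ {U : VField E M}, IsSmoothVF U → ∀ {ψ : M → ℝ}, ContMDiff 𝓘(ℝ, E) 𝓘(ℝ, ℝ) ∞ ψ →
      IsSmoothVF fun y => ψ y • U y := fun hU ψ hψ => ContMDiff.smul_section hψ hU
  have double : ∀ {X Y : VField E M}, IsSmoothVF X → IsSmoothVF Y →
      WeakF.bracket X (WeakF.bracket Y fun y => φ y • Z y) x =
        φ x • WeakF.bracket X (WeakF.bracket Y Z) x + dirDeriv X φ x • WeakF.bracket Y Z x
          + (dirDeriv Y φ x • WeakF.bracket X Z x + dirDeriv X (dirDeriv Y φ) x • Z x) := by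
    intro X Y hX hY
    have hYφ := contMDiff_dirDeriv hY hφ
    rw [step hZ hφ, bracket_add X ((sm (hY.bracket hZ) hφ).mdifferentiableAt x)
      ((sm hZ hYφ).mdifferentiableAt x), step (hY.bracket hZ) hφ, step hZ hYφ]
    rfl
  have j := congrFun (bracket_jacobi hX hY (sm hZ hφ)) x
  have j' := congrFun (bracket_jacobi hX hY hZ) x
  rw [double hX hY, Pi.add_apply, double hY hX, step hZ hφ, j'] at j
  simp only [Pi.add_apply, smul_add] at j
  have h : (dirDeriv (WeakF.bracket X Y) φ x
      - (dirDeriv X (dirDeriv Y φ) x - dirDeriv Y (dirDeriv X φ) x)) • Z x = 0 := by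
    rw [sub_smul, sub_smul, sub_eq_zero]
    rw [← sub_eq_zero] at j ⊢
    rw [← neg_eq_zero, ← j]
    abel
  exact sub_eq_zero.1 ((smul_eq_zero.1 h).resolve_right hx)

end Sections

section

variable {E : Type*} [NormedAddCommGroup E] [NormedSpace ℝ E]
  {M : Type*} [TopologicalSpace M] [ChartedSpace E M] [IsManifold 𝓘(ℝ, E) ∞ M]
  [RiemannianBundle (fun x : M => TangentSpace 𝓘(ℝ, E) x)]
  [IsContMDiffRiemannianBundle 𝓘(ℝ, E) ∞ E (fun x : M => TangentSpace 𝓘(ℝ, E) x)]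

theorem contMDiff_metric {X Y : VField E M} (hX : IsSmoothVF X) (hY : IsSmoothVF Y) :
    ContMDiff 𝓘(ℝ, E) 𝓘(ℝ, ℝ) ∞ (metric X Y) :=
  fun x => contMDiffAt_metric (hX x) (hY x)

variable [FiniteDimensional ℝ E]

theorem nabla_sub_nabla_eq {X Y : VField E M} (hX : IsSmoothVF X) (hY : IsSmoothVF Y) (x : M) :
    nabla X Y x - nabla Y X x = bracket X Y x := by
  have hD : IsSmoothVF (nabla X Y - nabla Y X - bracket X Y) :=
    ContMDiff.sub_section (ContMDiff.sub_section (hX.nabla hY) (hY.nabla hX)) (hX.bracket hY)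
  have h := nabla_sub_nabla (hX.mdifferentiableAt x) (hY.mdifferentiableAt x)
    (hD.mdifferentiableAt x)
  rw [← sub_eq_zero]
  refine inner_self_eq_zero (𝕜 := ℝ).1 ?_
  simp only [metric] at h
  rw [inner_sub_left, inner_sub_left, sub_eq_zero]
  exact h

/-- The smooth vector fields on a Riemannian manifold with a nowhere vanishing field, as a
Lie–Rinehart algebra with its Levi-Civita connection. -/
def leviCivita (Z : VField E M) (hZ : IsSmoothVF Z) (hZ0 : ∀ x, Z x ≠ 0) :
    LeviCivita (SmoothFun E M) (smoothFields E M) where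
  act X a := ⟨dirDeriv X.1 a, contMDiff_dirDeriv X.2 a.contMDiff⟩
  br X Y := ⟨bracket X.1 Y.1, IsSmoothVF.bracket X.2 Y.2⟩
  g := LinearMap.mk₂ _ (fun X Y => ⟨metric X.1 Y.1, contMDiff_metric X.2 Y.2⟩)
    (fun X Y Z => ContMDiffMap.ext fun x => inner_add_left (X.1 x) (Y.1 x) (Z.1 x))
    (fun a X Y => ContMDiffMap.ext fun x => real_inner_smul_left (X.1 x) (Y.1 x) (a x))
    (fun X Y Z => ContMDiffMap.ext fun x => inner_add_right (X.1 x) (Y.1 x) (Z.1 x))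
    (fun a X Y => ContMDiffMap.ext fun x => real_inner_smul_right (X.1 x) (Y.1 x) (a x))
  nab X Y := ⟨nabla X.1 Y.1, IsSmoothVF.nabla X.2 Y.2⟩
  g_comm X Y := ContMDiffMap.ext fun x => real_inner_comm (Y.1 x) (X.1 x)
  g_self _ h := Subtype.ext (funext fun x => inner_self_eq_zero (𝕜 := ℝ).1
    (congrArg (fun a : SmoothFun E M => a x) h))
  act_add X a b := ContMDiffMap.ext fun _ =>
    dirDeriv_add X.1 a.mdifferentiableAt b.mdifferentiableAt
  act_mul X a b := ContMDiffMap.ext fun _ =>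
    dirDeriv_mul X.1 a.mdifferentiableAt b.mdifferentiableAt
  act_br X Y a := ContMDiffMap.ext fun x => dirDeriv_bracket X.2 Y.2 hZ a.contMDiff (hZ0 x)
  jacobi X Y Z := Subtype.ext (bracket_jacobi X.2 Y.2 Z.2)
  br_swap _ _ := Subtype.ext VectorField.mlieBracket_swap
  br_add X Y Z := Subtype.ext (funext fun x => bracket_add X.1
    (IsSmoothVF.mdifferentiableAt Y.2 x) (IsSmoothVF.mdifferentiableAt Z.2 x))
  br_smul X a Y := Subtype.ext (funext fun x => bracket_smul X.1 a.mdifferentiableAt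
    (IsSmoothVF.mdifferentiableAt Y.2 x))
  torsion X Y := Subtype.ext (funext fun x => nabla_sub_nabla_eq X.2 Y.2 x)
  compat X Y Z := ContMDiffMap.ext fun x => dirDeriv_metric
    (IsSmoothVF.mdifferentiableAt X.2 x) (IsSmoothVF.mdifferentiableAt Y.2 x)
    (IsSmoothVF.mdifferentiableAt Z.2 x)

end

end WeakF

/-! ### Pointwise consequences of the structure axioms. -/

namespace WeakF.Tensors

variable {E : Type*} [NormedAddCommGroup E] [NormedSpace ℝ E]
  {M : Type*} [TopologicalSpace M] [ChartedSpace E M] [IsManifold 𝓘(ℝ, E) ∞ M] {s n : ℕ}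
  {T : Tensors E M s}

theorem isSmoothVF_fOp (T : Tensors E M s) {X : VField E M} (hX : IsSmoothVF X) :
    IsSmoothVF (T.fOp X) :=
  ContMDiff.clm_bundle_apply (b := fun x => x) (F₁ := E) (F₂ := E) T.smooth_f hX

theorem isSmoothVF_QOp (T : Tensors E M s) {X : VField E M} (hX : IsSmoothVF X) :
    IsSmoothVF (T.QOp X) :=
  ContMDiff.clm_bundle_apply (b := fun x => x) (F₁ := E) (F₂ := E) T.smooth_Q hX

theorem IsFramedWeak.ξ_ne_zero (hT : T.IsFramedWeak n) (i : Fin s) (x : M) : T.ξ i x ≠ 0 := by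
  intro h
  have h1 := hT.η_ξ i i x
  rw [h, map_zero, if_pos rfl] at h1
  exact zero_ne_one h1

theorem IsFramedWeak.Q_injective (hT : T.IsFramedWeak n) (x : M) :
    Function.Injective (T.Q x) := by
  obtain ⟨e, he⟩ := hT.nonsingular x
  rw [← he]
  exact e.injective

theorem IsFramedWeak.Q_inverse (hT : T.IsFramedWeak n) (x : M) (v : TangentSpace 𝓘(ℝ, E) x) :
    T.Q x ((T.Q x).inverse v) = v := by
  obtain ⟨e, he⟩ := hT.nonsingular x
  rw [← he, ContinuousLinearMap.inverse_equiv]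
  exact e.apply_symm_apply v

/-- A dimension count: `ker f` has dimension `s` by the rank condition, and `ker f²` lies in the
span of the `s` fields `ξ_j`. The two kernels therefore coincide, and `f² ξ_i = 0`. -/
theorem IsFramedWeak.f_ξ [FiniteDimensional ℝ E] (hT : T.IsFramedWeak n)
    (hE : Module.finrank ℝ E = 2 * n + s) (i : Fin s) (x : M) : T.f x (T.ξ i x) = 0 := by
  set F := (T.f x).toLinearMap with hF
  have hker : Module.finrank ℝ (LinearMap.ker F) = s := by
    have h := F.finrank_range_add_finrank_ker
    rw [hT.rank_f x, show Module.finrank ℝ (TangentSpace 𝓘(ℝ, E) x) = 2 * n + s from hE] at h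
    omega
  have hle : LinearMap.ker F ≤ LinearMap.ker (F ∘ₗ F) := LinearMap.ker_le_ker_comp F F
  have hspan : LinearMap.ker (F ∘ₗ F) ≤ Submodule.span ℝ (Set.range fun i => T.ξ i x) := by
    intro v hv
    have h : T.f x (T.f x v) = 0 := hv
    rw [hT.f_sq, neg_add_eq_zero] at h
    have h2 : v = ∑ i, T.η i x v • T.ξ i x := by
      refine hT.Q_injective x ?_
      rw [h, map_sum]
      simp only [map_smul, hT.Q_ξ]
    rw [h2]
    exact Submodule.sum_mem _ fun i _ => Submodule.smul_mem _ _ (Submodule.subset_span ⟨i, rfl⟩)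
  have hfin : Module.finrank ℝ (LinearMap.ker (F ∘ₗ F)) ≤ Module.finrank ℝ (LinearMap.ker F) := by
    rw [hker]
    refine (Submodule.finrank_mono hspan).trans ?_
    exact (finrank_range_le_card (R := ℝ) (fun i => T.ξ i x)).trans_eq (Fintype.card_fin s)
  have heq := Submodule.eq_of_le_of_finrank_le hle hfin
  have hmem : T.ξ i x ∈ LinearMap.ker (F ∘ₗ F) := by
    change T.f x (T.f x (T.ξ i x)) = 0
    rw [hT.f_sq, hT.Q_ξ]
    simp [hT.η_ξ]
  rw [← heq] at hmem
  exact hmem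

variable [RiemannianBundle (fun x : M => TangentSpace 𝓘(ℝ, E) x)]

theorem IsWeakMetric.Q_symm (hT : T.IsWeakMetric n) (x : M) (v w : TangentSpace 𝓘(ℝ, E) x) :
    inner ℝ (T.Q x v) w = inner ℝ v (T.Q x w) := by
  have h1 := hT.compat x v w
  have h2 := hT.compat x w v
  rw [real_inner_comm] at h2
  rw [real_inner_comm]
  simp only [mul_comm (T.η _ x w)] at h2
  linarith

variable [FiniteDimensional ℝ E]

theorem IsWeakMetric.η_eq (hT : T.IsWeakMetric n) (hE : Module.finrank ℝ E = 2 * n + s)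
    (i : Fin s) (x : M) (v : TangentSpace 𝓘(ℝ, E) x) : T.η i x v = inner ℝ v (T.ξ i x) := by
  have h := hT.compat x v (T.ξ i x)
  rw [hT.f_ξ hE, inner_zero_right, hT.Q_ξ] at h
  simp only [hT.η_ξ, mul_ite, mul_one, mul_zero, Finset.sum_ite_eq', Finset.mem_univ,
    if_true] at h
  linarith

theorem IsWeakMetric.η_Q (hT : T.IsWeakMetric n) (hE : Module.finrank ℝ E = 2 * n + s)
    (i : Fin s) (x : M) (v : TangentSpace 𝓘(ℝ, E) x) : T.η i x (T.Q x v) = T.η i x v := by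
  rw [hT.η_eq hE, hT.Q_symm, hT.Q_ξ, hT.η_eq hE]

/-- Compute `f³` as `f² ∘ f` and as `f ∘ f²`. -/
theorem IsWeakMetric.sum_η_f (hT : T.IsWeakMetric n) (hE : Module.finrank ℝ E = 2 * n + s)
    (x : M) (v : TangentSpace 𝓘(ℝ, E) x) :
    ∑ i, T.η i x (T.f x v) • T.ξ i x = T.Q x (T.f x v) - T.f x (T.Q x v) := by
  have h1 := hT.f_sq x (T.f x v)
  have h2 := congrArg (T.f x) (hT.f_sq x v)
  simp only [map_add, map_neg, map_sum, map_smul, hT.f_ξ hE, smul_zero, Finset.sum_const_zero,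
    add_zero] at h2
  rw [h2] at h1
  rw [sub_eq_add_neg, h1]
  abel

/-- Applying `η^i` to `sum_η_f` and using `η^i ∘ Q = η^i` gives `η^i ∘ f ∘ Q = 0`; `Q` is
surjective. -/
theorem IsWeakMetric.η_f (hT : T.IsWeakMetric n) (hE : Module.finrank ℝ E = 2 * n + s)
    (i : Fin s) (x : M) (v : TangentSpace 𝓘(ℝ, E) x) : T.η i x (T.f x v) = 0 := by
  rw [← hT.Q_inverse x v]
  set w := (T.Q x).inverse v
  have h := congrArg (T.η i x) (hT.sum_η_f hE x w)
  simp only [map_sum, map_sub, map_smul, hT.η_ξ, hT.η_Q hE, smul_eq_mul, mul_ite, mul_one,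
    mul_zero, Finset.sum_ite_eq, Finset.mem_univ, if_true] at h
  linarith

theorem IsWeakMetric.f_Q (hT : T.IsWeakMetric n) (hE : Module.finrank ℝ E = 2 * n + s)
    (x : M) (v : TangentSpace 𝓘(ℝ, E) x) : T.f x (T.Q x v) = T.Q x (T.f x v) := by
  have h := hT.sum_η_f hE x v
  simp only [hT.η_f hE, zero_smul, Finset.sum_const_zero] at h
  exact (sub_eq_zero.1 h.symm).symm

theorem IsWeakMetric.f_skew (hT : T.IsWeakMetric n) (hE : Module.finrank ℝ E = 2 * n + s)
    (x : M) (v w : TangentSpace 𝓘(ℝ, E) x) :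
    inner ℝ (T.f x v) w = -inner ℝ v (T.f x w) := by
  rw [← hT.Q_inverse x v]
  set u := (T.Q x).inverse v
  have h := hT.compat x u (T.f x w)
  simp only [hT.η_f hE, mul_zero, Finset.sum_const_zero, sub_zero, hT.f_sq, inner_add_right,
    inner_neg_right, inner_sum, inner_smul_right, ← hT.η_eq hE, add_zero] at h
  rw [hT.f_Q hE, hT.Q_symm, hT.Q_symm, ← h, neg_neg]

variable [IsContMDiffRiemannianBundle 𝓘(ℝ, E) ∞ E (fun x : M => TangentSpace 𝓘(ℝ, E) x)]

/-- The algebraic data of a weak almost `S`-structure with `£_{ξ_i} Q = 0`. -/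
def IsWeakAlmostS.weakS (hT : T.IsWeakAlmostS n) (hE : Module.finrank ℝ E = 2 * n + s)
    (hLie : T.LieQZero) (i₀ : Fin s) :
    (leviCivita (T.ξ i₀) (T.smooth_ξ i₀) (hT.ξ_ne_zero i₀)).WeakS (Fin s) where
  f := { toFun X := ⟨T.fOp X.1, T.isSmoothVF_fOp X.2⟩
         map_add' X Y := Subtype.ext (funext fun x => map_add (T.f x) (X.1 x) (Y.1 x))
         map_smul' a X := Subtype.ext (funext fun x => map_smul (T.f x) (a x) (X.1 x)) }
  Q := { toFun X := ⟨T.QOp X.1, T.isSmoothVF_QOp X.2⟩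
         map_add' X Y := Subtype.ext (funext fun x => map_add (T.Q x) (X.1 x) (Y.1 x))
         map_smul' a X := Subtype.ext (funext fun x => map_smul (T.Q x) (a x) (X.1 x)) }
  ξ i := ⟨T.ξ i, T.smooth_ξ i⟩
  f_sq X := by
    refine Subtype.ext (funext fun x => ?_)
    have h := hT.f_sq x (X.1 x)
    simp only [hT.η_eq hE] at h
    simp only [AddSubgroup.coe_add, AddSubgroup.val_finsetSum, Pi.add_apply, Finset.sum_apply]
    exact h
  g_ξ i j := by
    ext x
    have h := hT.η_ξ j i x
    rw [hT.η_eq hE] at h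
    refine Eq.trans h ?_
    simp only [eq_comm (a := j)]
    split_ifs <;> rfl
  Q_ξ i := Subtype.ext (funext fun x => hT.Q_ξ i x)
  f_ξ i := Subtype.ext (funext fun x => hT.f_ξ hE i x)
  f_skew X Y := ContMDiffMap.ext fun x => hT.f_skew hE x (X.1 x) (Y.1 x)
  Q_symm X Y := ContMDiffMap.ext fun x => hT.Q_symm x (X.1 x) (Y.1 x)
  f_Q X := Subtype.ext (funext fun x => hT.f_Q hE x (X.1 x))
  Q_inj X h := Subtype.ext (funext fun x => hT.Q_injective x
    ((congrFun (congrArg Subtype.val h) x).trans (map_zero (T.Q x)).symm))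
  dη i X Y := by
    ext x
    have h := hT.dη_eq i X.1 Y.1 X.2 Y.2 x
    simp only [extDeriv, hT.η_eq hE] at h
    change (2 : SmoothFun E M) x * T.Phi X.1 Y.1 x = _
    rw [two_apply, h, ← mul_assoc, mul_one_div_cancel two_ne_zero, one_mul]
    rfl
  lieQ i X := Subtype.ext (funext fun x => sub_eq_zero.1 (hLie i X.1 X.2 x))

end WeakF.Tensors

/-! ### Transfer of the algebraic identities to the manifold. -/

namespace WeakF.Tensors.IsWeakAlmostS

variable {E : Type*} [NormedAddCommGroup E] [NormedSpace ℝ E] [FiniteDimensional ℝ E]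
  {M : Type*} [TopologicalSpace M] [ChartedSpace E M] [IsManifold 𝓘(ℝ, E) ∞ M] {s n : ℕ}
  {T : Tensors E M s}
  [RiemannianBundle (fun x : M => TangentSpace 𝓘(ℝ, E) x)]
  [IsContMDiffRiemannianBundle 𝓘(ℝ, E) ∞ E (fun x : M => TangentSpace 𝓘(ℝ, E) x)]
  (hT : T.IsWeakAlmostS n) (hE : Module.finrank ℝ E = 2 * n + s) (hLie : T.LieQZero) (i₀ : Fin s)

include hT hE hLie

theorem nPhi_eq (X Y Z : smoothFields E M) (x : M) :
    T.nPhi X.1 Y.1 Z.1 x = (hT.weakS hE hLie i₀).N X Y Z x := by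
  have h := congrArg (fun a : SmoothFun E M => a x)
    ((leviCivita (T.ξ i₀) (T.smooth_ξ i₀) (hT.ξ_ne_zero i₀)).compat X Y
      ((hT.weakS hE hLie i₀).f Z))
  change _ = metric (nabla X.1 Y.1) (T.fOp Z.1) x + metric Y.1 (nabla X.1 (T.fOp Z.1)) x at h
  change dirDeriv X.1 (metric Y.1 (T.fOp Z.1)) x - metric (nabla X.1 Y.1) (T.fOp Z.1) x
      - metric Y.1 (T.fOp (nabla X.1 Z.1)) x =
    metric Y.1 (nabla X.1 (T.fOp Z.1)) x - metric Y.1 (T.fOp (nabla X.1 Z.1)) x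
  change dirDeriv X.1 (metric Y.1 (T.fOp Z.1)) x = _ at h
  rw [h]
  ring

theorem h_eq (i : Fin s) (X : smoothFields E M) :
    T.h i X.1 = ((hT.weakS hE hLie i₀).f ((hT.weakS hE hLie i₀).S i X)).1 := by
  funext x
  have h := congrFun (congrArg Subtype.val ((hT.weakS hE hLie i₀).lie_f i X)) x
  rw [(hT.weakS hE hLie i₀).S_f, smul_neg, neg_neg] at h
  change lieDerivEndo (T.ξ i) T.fOp X.1 x = (2 : SmoothFun E M) x • _ at h
  rw [Tensors.h, h, two_apply, smul_smul]
  norm_num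

/-- As `Q` commutes with `f` and `h_i = f S_i`, the left side is `Q⁻¹ f² S_i`, and `f² = -Q` on the
image of `S_i`. The comparison is made after applying `Q`. -/
theorem fht_eq (i : Fin s) (X : smoothFields E M) :
    T.fht i X.1 = (-(hT.weakS hE hLie i₀).S i X).1 := by
  funext x
  have h := congrFun (congrArg Subtype.val ((hT.weakS hE hLie i₀).Q_S i X)) x
  rw [(hT.weakS hE hLie i₀).S_f, map_neg] at h
  refine hT.Q_injective x ?_
  change T.Q x (T.f x ((T.Q x).inverse (T.h i X.1 x))) = T.Q x (-((hT.weakS hE hLie i₀).S i X).1 x)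
  rw [← hT.f_Q hE, hT.Q_inverse, hT.h_eq hE hLie i₀, map_neg]
  change T.Q x (((hT.weakS hE hLie i₀).S i X).1 x) = _ at h
  rw [h]
  exact (neg_neg _).symm

theorem curv_ξ (i : Fin s) {X Y Z : VField E M} (hX : IsSmoothVF X) (hY : IsSmoothVF Y)
    (hZ : IsSmoothVF Z) (x : M) :
    metric (curv (T.ξ i) X Y) Z x = - T.nPhi X Y Z x
      - metric X (nablaEndo (T.fht i) Y Z) x + metric X (nablaEndo (T.fht i) Z Y) x := by
  lift X to smoothFields E M using hX
  lift Y to smoothFields E M using hY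
  lift Z to smoothFields E M using hZ
  set W := hT.weakS hE hLie i
  have h := congrArg (fun a : SmoothFun E M => a x) (W.curv_ξ i X Y Z)
  have e : ∀ Y Z : smoothFields E M, nablaEndo (T.fht i) Y.1 Z.1 =
      (-((leviCivita (T.ξ i) (T.smooth_ξ i) (hT.ξ_ne_zero i)).nab Y (W.S i Z)
        - W.S i ((leviCivita (T.ξ i) (T.smooth_ξ i) (hT.ξ_ne_zero i)).nab Y Z))).1 := by
    intro Y Z
    have h1 : T.fht i (nabla Y.1 Z.1) = _ := hT.fht_eq hE hLie i i
      ((leviCivita (T.ξ i) (T.smooth_ξ i) (hT.ξ_ne_zero i)).nab Y Z)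
    have h2 : nabla Y.1 (-(W.S i Z)).1 = _ := congrArg Subtype.val
      ((leviCivita (T.ξ i) (T.smooth_ξ i) (hT.ξ_ne_zero i)).nab_neg Y (W.S i Z))
    funext x
    rw [nablaEndo, hT.fht_eq hE hLie i, h1, h2, neg_sub]
    exact (neg_sub_neg _ _)
  rw [e, e, hT.nPhi_eq hE hLie i]
  have e2 : ∀ U V : smoothFields E M, metric U.1 (-V).1 x = -metric U.1 V.1 x := fun U V =>
    inner_neg_right _ _
  rw [e2, e2]
  refine Eq.trans h ?_
  rw [sub_neg_eq_add]
  exact (sub_eq_add_neg _ _)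

/-- Fields of the form `fX` are sections of `D`, so the hypothesis supplies exactly what `Q_eq_self`
needs. -/
theorem QOp_eq (hs : 0 < s) (hQ : T.NablaQZeroOnD) (X : smoothFields E M) (x : M) :
    T.Q x (X.1 x) = X.1 x := by
  have : Nonempty (Fin s) := ⟨⟨0, hs⟩⟩
  refine congrFun (congrArg Subtype.val ((hT.weakS hE hLie ⟨0, hs⟩).Q_eq_self (fun X Y => ?_) X)) x
  exact Subtype.ext (funext fun x => sub_eq_zero.1 (hQ (T.fOp X.1) (T.fOp Y.1)
    (T.isSmoothVF_fOp X.2) (T.isSmoothVF_fOp Y.2) (fun i x => hT.η_f hE i x (X.1 x))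
    (fun i x => hT.η_f hE i x (Y.1 x)) x))

theorem ht_eq (hQ : ∀ (X : smoothFields E M) x, T.Q x (X.1 x) = X.1 x) (i : Fin s)
    (X : smoothFields E M) :
    T.ht i X.1 = ((hT.weakS hE hLie i₀).f ((hT.weakS hE hLie i₀).S i X)).1 := by
  funext x
  refine hT.Q_injective x ?_
  rw [hQ, ht, hT.Q_inverse, hT.h_eq hE hLie i₀]

theorem QQh_eq (hQ : ∀ (X : smoothFields E M) x, T.Q x (X.1 x) = X.1 x) (j : Fin s)
    (X : smoothFields E M) : T.QQh j X.1 = 0 := by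
  funext x
  rw [QQh, hT.ht_eq hE hLie j hQ]
  exact sub_eq_zero.2 (hQ ⟨_, T.isSmoothVF_QOp
    (X - (hT.weakS hE hLie j).f ((hT.weakS hE hLie j).S j X)).2⟩ x)

theorem nabla_f_add (hs : 0 < s) (hQ : T.NablaQZeroOnD) {X Y : VField E M} (hX : IsSmoothVF X)
    (hY : IsSmoothVF Y) (x : M) :
    nablaEndo T.fOp X Y x + nablaEndo T.fOp (T.fOp X) (T.fOp Y) x =
        (2 * metric (T.fOp X) (T.fOp Y) x) • (∑ j, T.ξ j x)
        + T.etaBar Y x • T.fOp (T.fOp X) x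
        - ∑ j, T.etaOp j Y x • T.h j X x
        - T.P X Y x
        + (1 / 2 : ℝ) • ∑ j,
          (T.QQh j (fun y => T.etaOp j X y • Y y - T.etaOp j Y y • X y) x
            + metric (T.QQh j Y) X x • T.ξ j x) := by
  lift X to smoothFields E M using hX
  lift Y to smoothFields E M using hY
  set L := leviCivita (T.ξ ⟨0, hs⟩) (T.smooth_ξ ⟨0, hs⟩) (hT.ξ_ne_zero ⟨0, hs⟩) with hL
  set W := hT.weakS hE hLie ⟨0, hs⟩ with hW
  have : Nonempty (Fin s) := ⟨⟨0, hs⟩⟩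
  have hQ' := hT.QOp_eq hE hLie hs hQ
  have hWQ : ∀ X, W.Q X = X := fun X => Subtype.ext (funext (hQ' X))
  have hQt : ∀ X : smoothFields E M, T.Qt X.1 = (0 : smoothFields E M).1 := fun X =>
    funext fun x => sub_eq_zero.2 (hQ' X x)
  have hη : ∀ j (X : smoothFields E M) y, T.etaOp j X.1 y = L.g X (W.ξ j) y := fun j X y =>
    hT.η_eq hE j y (X.1 y)
  have hbar : T.etaBar Y.1 x = W.etaBar Y x :=
    (Finset.sum_congr rfl fun j _ => hη j Y x).trans
      (map_sum (ContMDiffMap.evalRingHom x) (fun j => L.g Y (W.ξ j)) _).symm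
  have hqq : ∀ j, T.QQh j (fun y => T.etaOp j X.1 y • Y.1 y - T.etaOp j Y.1 y • X.1 y) = 0 := by
    intro j
    simp only [hη]
    exact hT.QQh_eq hE hLie hQ' j (L.g X (W.ξ j) • Y - L.g Y (W.ξ j) • X)
  have hP : T.P X.1 Y.1 x = 0 := by
    have h1 : L.nab X (W.f 0) - W.f (L.nab X 0) + (L.nab 0 (W.f Y) - W.f (L.nab 0 Y)) = 0 := by
      simp only [map_zero, L.nab_zero, L.nab_zero_left, sub_zero, add_zero]
    rw [P, hQt, hQt]
    exact smul_eq_zero_of_right _ (congrFun (congrArg Subtype.val h1) x)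
  have key : L.nab X (W.f Y) - W.f (L.nab X Y)
      + (L.nab (W.f X) (W.f (W.f Y)) - W.f (L.nab (W.f X) (W.f Y))) =
      (2 * L.g (W.f X) (W.f Y)) • ∑ j, W.ξ j + W.etaBar Y • W.f (W.f X)
        - ∑ j, L.g Y (W.ξ j) • W.f (W.S j X) := by
    refine L.ext_g fun Z => ?_
    have h := W.N_add_N_f hWQ X Y Z
    simp only [LeviCivita.WeakS.N] at h
    have e1 := W.f_skew (W.f X) Z
    have e2 : ∀ j, L.g Z (W.f (W.S j X)) = -L.g (W.S j X) (W.f Z) := fun j => by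
      rw [L.g_comm, W.f_skew]
    rw [L.g_comm] at e1
    simp only [map_add, map_sub, map_smul, map_sum, smul_eq_mul, e1, e2, mul_neg,
      Finset.sum_neg_distrib]
    rw [LeviCivita.WeakS.etaBar, LeviCivita.WeakS.σ] at h
    rw [h]
    ring
  have k := congrFun (congrArg Subtype.val key) x
  simp only [AddSubgroup.coe_add, AddSubgroup.coe_sub, AddSubgroup.val_finsetSum, Pi.add_apply,
    Pi.sub_apply, Finset.sum_apply, smul_val] at k
  simp only [hqq]
  simp only [hT.QQh_eq hE hLie hQ', hP, hbar, hη, hT.h_eq hE hLie ⟨0, hs⟩]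
  have m0 : metric (0 : VField E M) X.1 x = 0 := inner_zero_left _
  simp only [m0, Pi.zero_apply, zero_smul, add_zero, Finset.sum_const_zero, smul_zero, sub_zero]
  refine Eq.trans k ?_
  congr 3
  change (2 : SmoothFun E M) x * _ = _
  rw [two_apply]
  rfl

theorem curv_ξ_sum (hs : 0 < s) (hQ : T.NablaQZeroOnD) (i : Fin s) {X Y Z : VField E M}
    (hX : IsSmoothVF X) (hY : IsSmoothVF Y) (hZ : IsSmoothVF Z) (x : M) :
    metric (curv (T.ξ i) X Y) Z x
        + metric (curv (T.ξ i) (T.Qt X) Y) Z x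
        - metric (curv (T.ξ i) X (T.fOp Y)) (T.fOp Z) x
        + metric (curv (T.ξ i) (T.fOp X) Y) (T.fOp Z) x
        + metric (curv (T.ξ i) (T.fOp X) (T.fOp Y)) Z x =
      2 * T.nPhi (T.ht i X) Y Z x
        + 2 * T.etaBar Z x * metric (X + T.ht i X) (T.QOp Y) x
        - 2 * T.etaBar Y x * metric (X + T.ht i X) (T.QOp Z) x
        - 2 * ∑ j, T.etaOp j X x *
            (T.etaOp j Y x * T.etaBar Z x - T.etaBar Y x * T.etaOp j Z x)
        + (1 / 2 : ℝ) *
          (∑ j, (2 * T.etaOp j X x * metric (T.QQh j Z) Y x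
              - 5 * T.etaOp j Y x * metric (T.QQh j Z) (T.ht i X + (2 / 5 : ℝ) • X) x
              + 5 * T.etaOp j Z x * metric (T.QQh j Y) (T.ht i X) x)
            - T.nPhi (T.Qt Y) Z (T.ht i X) x
            + T.nPhi Y (T.ht i Z) (T.Qt X) x
            + 3 * T.nPhi (T.Qt (T.ht i X)) Y Z x
            - T.nPhi (T.Qt Y) (T.ht i Z) X x
            - T.nPhi (T.Qt Z) (T.ht i X) Y x
            + T.nPhi Z (T.Qt X) (T.ht i Y) x
            - T.nPhi (T.Qt Z) X (T.ht i Y) x) := by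
  lift X to smoothFields E M using hX
  lift Y to smoothFields E M using hY
  lift Z to smoothFields E M using hZ
  set L := leviCivita (T.ξ i) (T.smooth_ξ i) (hT.ξ_ne_zero i) with hL
  set W := hT.weakS hE hLie i with hW
  have : Nonempty (Fin s) := ⟨i⟩
  have hQ' := hT.QOp_eq hE hLie hs hQ
  have hWQ : ∀ X, W.Q X = X := fun X => Subtype.ext (funext (hQ' X))
  have hQt : ∀ X : smoothFields E M, T.Qt X.1 = (0 : smoothFields E M).1 := fun X =>
    funext fun x => sub_eq_zero.2 (hQ' X x)
  have hQO : ∀ X : smoothFields E M, T.QOp X.1 = X.1 := fun X => funext (hQ' X)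
  have hht : ∀ X : smoothFields E M, T.ht i X.1 = (W.f (W.S i X)).1 :=
    hT.ht_eq hE hLie i hQ' i
  have hbar : ∀ Y : smoothFields E M, T.etaBar Y.1 x = W.etaBar Y x := fun Y =>
    (Finset.sum_congr rfl fun j _ => hT.η_eq hE j x (Y.1 x)).trans
      (map_sum (ContMDiffMap.evalRingHom x) (fun j => L.g Y (W.ξ j)) _).symm
  have hN : ∀ X Y Z : smoothFields E M, T.nPhi X.1 Y.1 Z.1 x = W.N X Y Z x := fun X Y Z =>
    hT.nPhi_eq hE hLie i X Y Z x
  have hc0 : metric (curv (T.ξ i) (0 : smoothFields E M).1 Y.1) Z.1 x = 0 := by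
    have h : L.g (L.curv (W.ξ i) 0 Y) Z = 0 := by
      simp only [L.curv_pair _ 0, L.g_comm _ 0, map_zero, LinearMap.zero_apply]
    exact congrArg (fun a : SmoothFun E M => a x) h
  have m0 : ∀ U : VField E M, metric 0 U x = 0 := fun U => inner_zero_left _
  have madd : ∀ U V : VField E M, ∀ Y : VField E M,
      metric (U + V) Y x = metric U Y x + metric V Y x := fun U V Y => inner_add_left _ _ _
  have k := congrArg (fun a : SmoothFun E M => a x) (W.curv_ξ_sum hWQ i X Y Z)
  change metric (curv (T.ξ i) X.1 Y.1) Z.1 x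
      - metric (curv (T.ξ i) X.1 (T.fOp Y.1)) (T.fOp Z.1) x
      + metric (curv (T.ξ i) (T.fOp X.1) Y.1) (T.fOp Z.1) x
      + metric (curv (T.ξ i) (T.fOp X.1) (T.fOp Y.1)) Z.1 x =
    (2 : SmoothFun E M) x * W.N (W.f (W.S i X)) Y Z x
      + (2 : SmoothFun E M) x * W.etaBar Z x *
        (metric (T.fOp X.1) (T.fOp Y.1) x + metric (W.f (W.S i X)).1 Y.1 x)
      - (2 : SmoothFun E M) x * W.etaBar Y x *
        (metric (T.fOp X.1) (T.fOp Z.1) x + metric (W.f (W.S i X)).1 Z.1 x) at k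
  -- Rewriting `g(fX, fY)` through the compatibility condition is the source of the term `-2 ∑
  -- η^j(X)[…]` in (2).
  have hG : ∀ Y : smoothFields E M, metric (T.fOp X.1) (T.fOp Y.1) x =
      metric X.1 Y.1 x - ∑ j, T.etaOp j X.1 x * T.etaOp j Y.1 x := fun Y => by
    have h := hT.compat x (X.1 x) (Y.1 x)
    rw [hQ'] at h
    exact h
  have hsum : ∑ j, T.etaOp j X.1 x *
      (T.etaOp j Y.1 x * W.etaBar Z x - W.etaBar Y x * T.etaOp j Z.1 x) =
      W.etaBar Z x * ∑ j, T.etaOp j X.1 x * T.etaOp j Y.1 x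
        - W.etaBar Y x * ∑ j, T.etaOp j X.1 x * T.etaOp j Z.1 x := by
    rw [Finset.mul_sum, Finset.mul_sum, ← Finset.sum_sub_distrib]
    exact Finset.sum_congr rfl fun j _ => by ring
  have z : ((0 : SmoothFun E M) x) = 0 := rfl
  simp only [hQt, hQO, hht, hbar, hN, W.N_zero_left, W.N_zero_mid, W.N_zero_right, hc0, hT.QQh_eq hE hLie hQ', m0, madd, hsum, z,
    mul_zero, sub_zero, add_zero, Finset.sum_const_zero]
  rw [two_apply, hG, hG] at k
  rw [k]
  ring

end WeakF.Tensors.IsWeakAlmostS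

end

theorem mainTheorem9 (n s : ℕ) (hn : 0 < n) (hs : 0 < s)
    {M : Type*} [TopologicalSpace M] [T2Space M] [SecondCountableTopology M]
    [ChartedSpace (EuclideanSpace ℝ (Fin (2 * n + s))) M] [IsManifold (𝓡 (2 * n + s)) ∞ M]
    [RiemannianBundle (fun x : M => TangentSpace (𝓡 (2 * n + s)) x)]
    [IsContMDiffRiemannianBundle (𝓡 (2 * n + s)) ∞ (EuclideanSpace ℝ (Fin (2 * n + s)))
      (fun x : M => TangentSpace (𝓡 (2 * n + s)) x)]
    (T : WeakF.Tensors (EuclideanSpace ℝ (Fin (2 * n + s))) M s)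
    (hT : T.IsWeakAlmostS n) (hLie : T.LieQZero) :
    (∀ i : Fin s, ∀ X Y Z : WeakF.VField (EuclideanSpace ℝ (Fin (2 * n + s))) M,
      WeakF.IsSmoothVF X → WeakF.IsSmoothVF Y → WeakF.IsSmoothVF Z → ∀ x : M,
      WeakF.metric (WeakF.curv (T.ξ i) X Y) Z x =
        - T.nPhi X Y Z x
        - WeakF.metric X (WeakF.nablaEndo (T.fht i) Y Z) x
        + WeakF.metric X (WeakF.nablaEndo (T.fht i) Z Y) x) ∧
    (T.NablaQZeroOnD →
      ∀ i : Fin s, ∀ X Y Z : WeakF.VField (EuclideanSpace ℝ (Fin (2 * n + s))) M,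
      WeakF.IsSmoothVF X → WeakF.IsSmoothVF Y → WeakF.IsSmoothVF Z → ∀ x : M,
      WeakF.metric (WeakF.curv (T.ξ i) X Y) Z x
        + WeakF.metric (WeakF.curv (T.ξ i) (T.Qt X) Y) Z x
        - WeakF.metric (WeakF.curv (T.ξ i) X (T.fOp Y)) (T.fOp Z) x
        + WeakF.metric (WeakF.curv (T.ξ i) (T.fOp X) Y) (T.fOp Z) x
        + WeakF.metric (WeakF.curv (T.ξ i) (T.fOp X) (T.fOp Y)) Z x =
      2 * T.nPhi (T.ht i X) Y Z x
        + 2 * T.etaBar Z x * WeakF.metric (X + T.ht i X) (T.QOp Y) x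
        - 2 * T.etaBar Y x * WeakF.metric (X + T.ht i X) (T.QOp Z) x
        - 2 * ∑ j, T.etaOp j X x *
            (T.etaOp j Y x * T.etaBar Z x - T.etaBar Y x * T.etaOp j Z x)
        + (1 / 2 : ℝ) *
          (∑ j, (2 * T.etaOp j X x * WeakF.metric (T.QQh j Z) Y x
              - 5 * T.etaOp j Y x *
                  WeakF.metric (T.QQh j Z) (T.ht i X + (2 / 5 : ℝ) • X) x
              + 5 * T.etaOp j Z x * WeakF.metric (T.QQh j Y) (T.ht i X) x)
            - T.nPhi (T.Qt Y) Z (T.ht i X) x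
            + T.nPhi Y (T.ht i Z) (T.Qt X) x
            + 3 * T.nPhi (T.Qt (T.ht i X)) Y Z x
            - T.nPhi (T.Qt Y) (T.ht i Z) X x
            - T.nPhi (T.Qt Z) (T.ht i X) Y x
            + T.nPhi Z (T.Qt X) (T.ht i Y) x
            - T.nPhi (T.Qt Z) X (T.ht i Y) x)) ∧
    (T.NablaQZeroOnD →
      ∀ X Y : WeakF.VField (EuclideanSpace ℝ (Fin (2 * n + s))) M,
      WeakF.IsSmoothVF X → WeakF.IsSmoothVF Y → ∀ x : M,
      WeakF.nablaEndo T.fOp X Y x + WeakF.nablaEndo T.fOp (T.fOp X) (T.fOp Y) x =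
        (2 * WeakF.metric (T.fOp X) (T.fOp Y) x) • (∑ j, T.ξ j x)
        + T.etaBar Y x • T.fOp (T.fOp X) x
        - ∑ j, T.etaOp j Y x • T.h j X x
        - T.P X Y x
        + (1 / 2 : ℝ) • ∑ j,
          (T.QQh j (fun y => T.etaOp j X y • Y y - T.etaOp j Y y • X y) x
            + WeakF.metric (T.QQh j Y) X x • T.ξ j x)) := by
  have hE : Module.finrank ℝ (EuclideanSpace ℝ (Fin (2 * n + s))) = 2 * n + s := by simp
  exact ⟨fun i X Y Z hX hY hZ x => hT.curv_ξ hE hLie i hX hY hZ x,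
    fun hQ i X Y Z hX hY hZ x => hT.curv_ξ_sum hE hLie hs hQ i hX hY hZ x,
    fun hQ X Y hX hY x => hT.nabla_f_add hE hLie hs hQ hX hY x⟩
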